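/- **Notation.** Let $n\ge 1$, $0\le k\le d$, let $a_1,\dots,a_n\in\mathbb R^d$, and let $d(x,F)=\inf_{y\in F}\|x-y\|_2$. A $k$-flat is a translate of a $k$-dimensional linear subspace of $\mathbb R^d$. For $T\subseteq[n]$ the *outer $(d-k)$ radius* of $\{a_i\}_{i\in T}$ is $R_k(T)=\min_{F\ k\text{-flat}}\max_{i\in T}d(a_i,F)$. Put $b_i=a_i-a_1$ (so $b_1=0$), let $B$ be the $n\times d$ matrix with rows $b_i$ (this is $A-a_1$), let $B_S$ be the submatrix of the rows in $S$ and $B_{1:i}$ that of the first $i$ rows, and let $R^0_k(S)=\min_{\dim V=k}\max_{i\in S}d(b_i,V)$, where $V$ runs over the $k$-dimensional linear subspaces; a maximum over the empty set is $0$. A set $S\subseteq[n]$ is a *coreset of distortion $\beta$* for $b_1,\dots,b_n$ if for every $k$-dimensional linear subspace $V$ $$\max_{i\in S}d(b_i,V)\ \le\ \max_{i\in[n]}d(b_i,V)\ \le\ \beta\max_{i\in S}d(b_i,V).$$ For $k\ge1$, the *streaming algorithm* on $b_1,\dots,b_n$ starts with $S=\emptyset$ and for $t=1,\dots,n$ computes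 $\lambda=\|B_S-[B_S]_k\|_F^2/k$, where $[\cdot]_k$ is the best rank-$k$ approximation in Frobenius norm (so $\lambda = 0$ for $S=\emptyset$), and adds $t$ to $S$ if either $\lambda=0$ and $b_t\notin\mathrm{rowspace}(B_S)$, or $b_t^{T}(B_S^{T}B_S+\lambda I)^{+}b_t\ge \frac1{1+1/k}$, where $^+$ is the Moore–Penrose pseudoinverse. The *online rank-$k$ condition number* of $B$ is $$\kappa'=\frac{\|B\|_2}{\min_{i\le i^*+1}\sigma_{\min}(B_{1:i})},$$ where $i^*$ is the largest index with $\mathrm{rank}(B_{1:i^*})=k$, $\sigma_{\min}$ is the smallest nonzero singular value, and the minimum is over the indices $1\le i\le \min(i^*+1,n)$ with $B_{1:i}\ne0$. (If $\mathrm{rank}(B)<k$, then $\kappa'$ is not defined, and $\log(n\kappa')$ is read as $0$ below.) **Theorem (Outer $(d-k)$ radius estimation).** There is an absolute constant $C>0$ such that for all $n,d,k,a_1,\dots,a_n$ as above: 1. If $S$ is a coreset of distortion $\beta$ for the points $b_i=a_i-a_1$, then the outer radius of the coreset points together with the base point $a_1$ is an $O(\beta)$-approximation to the outer radius of the whole point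 set: $$R_k(S\cup\{1\})\ \le\ R_k([n])\ \le\ C\beta\,R_k(S\cup\{1\}),$$ and so is the best $k$-dimensional subspace fit of the translated coreset points: $$R^0_k(S)\ \le\ C\,R_k([n])\qquad\text{and}\qquad R_k([n])\ \le\ C\beta\,R^0_k(S).$$ 2. If $k\ge1$ and $S$ is the coreset selected by the streaming algorithm on $b_1,\dots,b_n$, then $$R_k(S\cup\{1\})\ \le\ R_k([n])\ \le\ C\sqrt k\,\log(n\kappa')\,R_k(S\cup\{1\}),$$ $$R^0_k(S)\ \le\ C\,R_k([n])\qquad\text{and}\qquad R_k([n])\ \le\ C\sqrt k\,\log(n\kappa')\,R^0_k(S).$$ -/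

import Mathlib

namespace FlatFit

noncomputable section

/-- Points and rows live in `ℝ^d` with the Euclidean norm. -/
abbrev Pt (d : ℕ) : Type := EuclideanSpace ℝ (Fin d)

/-- `max_{i ∈ S} d(a_i, F)`, where `d` is the Euclidean distance to the set `F`
(and the maximum over the empty set is `0`). -/
def maxDist {n d : ℕ} (a : Fin n → Pt d) (S : Finset (Fin n)) (F : Set (Pt d)) : ℝ :=
  ⨆ i : S, Metric.infDist (a i) F

/-- The outer `(d-k)` radius of the points `a_i`, `i ∈ S`: the least value of
`max_{i ∈ S} d(a_i, F)` over all `k`-dimensional flats `F` (translates of `k`-dimensional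
linear subspaces, that is, nonempty affine subspaces with `k`-dimensional direction). -/
def outerRadius {n d : ℕ} (k : ℕ) (a : Fin n → Pt d) (S : Finset (Fin n)) : ℝ :=
  sInf {r : ℝ | ∃ F : AffineSubspace ℝ (Pt d), (F : Set (Pt d)).Nonempty ∧
    Module.finrank ℝ F.direction = k ∧ r = maxDist a S F}

/-- The optimal rank-`k` `ℓ_∞` subspace approximation cost of the points `b_i`, `i ∈ S`:
the least value of `max_{i ∈ S} d(b_i, V)` over all `k`-dimensional linear subspaces `V`. -/
def subspaceRadius {n d : ℕ} (k : ℕ) (b : Fin n → Pt d) (S : Finset (Fin n)) : ℝ :=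
  sInf {r : ℝ | ∃ V : Submodule ℝ (Pt d), Module.finrank ℝ V = k ∧ r = maxDist b S V}

/-- `S` is a strong coreset of distortion `β` for the points `b_1, …, b_n`: for every
`k`-dimensional linear subspace `V`,
`max_{i ∈ S} d(b_i, V) ≤ max_i d(b_i, V) ≤ β · max_{i ∈ S} d(b_i, V)`. -/
def IsStrongCoreset {n d : ℕ} (k : ℕ) (b : Fin n → Pt d) (S : Finset (Fin n)) (β : ℝ) : Prop :=
  ∀ V : Submodule ℝ (Pt d), Module.finrank ℝ V = k →
    maxDist b S V ≤ maxDist b Finset.univ V ∧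
    maxDist b Finset.univ V ≤ β * maxDist b S V

/-- The matrix `B_S` whose rows are the `b_i` with `i ∈ S`. -/
def rowsMatrix {n d : ℕ} (b : Fin n → Pt d) (S : Finset (Fin n)) : Matrix S (Fin d) ℝ :=
  Matrix.of fun i j => b i j

/-- The matrix `B_{1:i}` formed by the first `i` rows. -/
def prefixMatrix {n d : ℕ} (b : Fin n → Pt d) (i : ℕ) :
    Matrix (Finset.univ.filter fun j : Fin n => j.val < i) (Fin d) ℝ :=
  rowsMatrix b (Finset.univ.filter fun j : Fin n => j.val < i)

/-- `‖M - [M]_k‖_F²`, where `[M]_k` is a best approximation of `M` of rank at most `k`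
in Frobenius norm. -/
def rankResidualSq {d : ℕ} {ι : Type} [Fintype ι] (k : ℕ) (M : Matrix ι (Fin d) ℝ) : ℝ :=
  sInf {r : ℝ | ∃ N : Matrix ι (Fin d) ℝ, N.rank ≤ k ∧ r = ∑ i, ∑ j, (M i j - N i j) ^ 2}

/-- The Penrose equations: `P` is the Moore-Penrose pseudoinverse of `M`. -/
structure IsMoorePenrose {m n : Type} [Fintype m] [Fintype n]
    (M : Matrix m n ℝ) (P : Matrix n m ℝ) : Prop where
  mul_mul_self : M * P * M = M
  self_mul_mul : P * M * P = P
  symm_left : (M * P).transpose = M * P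
  symm_right : (P * M).transpose = P * M

theorem IsMoorePenrose.unique {m n : Type} [Fintype m] [Fintype n]
    {M : Matrix m n ℝ} {P Q : Matrix n m ℝ}
    (hP : IsMoorePenrose M P) (hQ : IsMoorePenrose M Q) : P = Q := by
  have h1 : M * P = M * Q := by
    calc M * P = (M * P).transpose := hP.symm_left.symm
      _ = ((M * Q) * (M * P)).transpose := by
          rw [← Matrix.mul_assoc (M * Q) M P, hQ.mul_mul_self]
      _ = (M * P) * (M * Q) := by
          rw [Matrix.transpose_mul, hP.symm_left, hQ.symm_left]
      _ = M * Q := by rw [← Matrix.mul_assoc (M * P) M Q, hP.mul_mul_self]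
  have h2 : P * M = Q * M := by
    calc P * M = (P * M).transpose := hP.symm_right.symm
      _ = ((P * M) * (Q * M)).transpose := by
          rw [Matrix.mul_assoc P M (Q * M), ← Matrix.mul_assoc M Q M, hQ.mul_mul_self]
      _ = (Q * M) * (P * M) := by
          rw [Matrix.transpose_mul, hP.symm_right, hQ.symm_right]
      _ = Q * M := by
          rw [Matrix.mul_assoc Q M (P * M), ← Matrix.mul_assoc M P M, hP.mul_mul_self]
  calc P = P * M * P := hP.self_mul_mul.symm
    _ = Q * M * P := by rw [h2]
    _ = Q * (M * Q) := by rw [Matrix.mul_assoc, h1]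
    _ = Q := by rw [← Matrix.mul_assoc, hQ.self_mul_mul]

open Classical in
/-- The Moore-Penrose pseudoinverse `M⁺`. -/
def pinv {m n : Type} [Fintype m] [Fintype n] (M : Matrix m n ℝ) : Matrix n m ℝ :=
  if h : ∃ P, IsMoorePenrose M P then h.choose else 0

/-- Symmetric matrices have a Moore-Penrose pseudoinverse. -/
theorem exists_isMoorePenrose {m : Type} [Fintype m] [DecidableEq m] (M : Matrix m m ℝ)
    (hM : M.IsHermitian) : ∃ P, IsMoorePenrose M P := by
  obtain ⟨U, e, hUU, hspec⟩ : ∃ (U : Matrix m m ℝ) (e : m → ℝ),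
      U.transpose * U = 1 ∧ M = U * Matrix.diagonal e * U.transpose := by
    have hs : star (hM.eigenvectorUnitary : Matrix m m ℝ)
        = (hM.eigenvectorUnitary : Matrix m m ℝ).transpose := by
      ext i j
      simp [Matrix.star_apply]
    refine ⟨hM.eigenvectorUnitary, hM.eigenvalues, ?_, ?_⟩
    · rw [← hs]
      exact Unitary.coe_star_mul_self hM.eigenvectorUnitary
    · have h := hM.spectral_theorem
      rw [Unitary.conjStarAlgAut_apply, hs] at h
      exact h
  have key : ∀ f g : m → ℝ,
      (U * Matrix.diagonal f * U.transpose) * (U * Matrix.diagonal g * U.transpose)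
        = U * Matrix.diagonal (fun i => f i * g i) * U.transpose := by
    intro f g
    calc _ = U * Matrix.diagonal f * (U.transpose * U) * Matrix.diagonal g * U.transpose := by
          simp only [Matrix.mul_assoc]
      _ = _ := by
          rw [hUU, Matrix.mul_one, Matrix.mul_assoc U, Matrix.diagonal_mul_diagonal]
  have ksymm : ∀ f : m → ℝ, (U * Matrix.diagonal f * U.transpose).transpose
      = U * Matrix.diagonal f * U.transpose := by
    intro f
    simp [Matrix.transpose_mul, Matrix.mul_assoc]
  refine ⟨U * Matrix.diagonal (fun i => (e i)⁻¹) * U.transpose, ?_, ?_, ?_, ?_⟩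
  · rw [hspec, key, key]
    congr 3
    funext i
    exact mul_inv_mul_cancel (e i)
  · rw [hspec, key, key]
    congr 3
    funext i
    by_cases h0 : e i = 0
    · simp [h0]
    · field_simp
  · rw [hspec, key, ksymm]
  · rw [hspec, key, ksymm]

theorem isMoorePenrose_pinv {m : Type} [Fintype m] [DecidableEq m] (M : Matrix m m ℝ)
    (hM : M.IsHermitian) : IsMoorePenrose M (pinv M) := by
  have h := exists_isMoorePenrose M hM
  rw [pinv, dif_pos h]
  exact h.choose_spec

/-- The ridge parameter `λ = ‖B_S - [B_S]_k‖_F² / k` of the rows selected so far. -/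
def ridgeParam {n d : ℕ} (k : ℕ) (b : Fin n → Pt d) (S : Finset (Fin n)) : ℝ :=
  rankResidualSq k (rowsMatrix b S) / k

/-- `b_tᵀ (B_Sᵀ B_S + λ I)⁺ b_t` with `λ = ridgeParam k b S`. -/
def ridgeScore {n d : ℕ} (k : ℕ) (b : Fin n → Pt d) (S : Finset (Fin n)) (t : Fin n) : ℝ :=
  (b t).ofLp ⬝ᵥ ((pinv ((rowsMatrix b S).transpose * rowsMatrix b S +
    ridgeParam k b S • (1 : Matrix (Fin d) (Fin d) ℝ))).mulVec (b t).ofLp)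

/-- The test by which row `t` is selected when `S` is the current set: either `λ = 0` and
`b_t` is not in the row space of `B_S`, or the ridge leverage score of `b_t`
is at least `1 / (1 + 1/k)`. -/
def Selects {n d : ℕ} (k : ℕ) (b : Fin n → Pt d) (S : Finset (Fin n)) (t : Fin n) : Prop :=
  (ridgeParam k b S = 0 ∧ b t ∉ Submodule.span ℝ (b '' (S : Set (Fin n)))) ∨
    1 / (1 + 1 / (k : ℝ)) ≤ ridgeScore k b S t

open Classical in
/-- The set held by the streaming algorithm after it has processed the first `t` rows. -/
def coresetAfter {n d : ℕ} (k : ℕ) (b : Fin n → Pt d) : ℕ → Finset (Fin n)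
  | 0 => ∅
  | t + 1 =>
    if h : t < n then
      if Selects k b (coresetAfter k b t) ⟨t, h⟩ then
        insert ⟨t, h⟩ (coresetAfter k b t)
      else coresetAfter k b t
    else coresetAfter k b t

/-- The output of the streaming algorithm on the stream of rows `b_1, …, b_n`. -/
def streamingCoreset {n d : ℕ} (k : ℕ) (b : Fin n → Pt d) : Finset (Fin n) :=
  coresetAfter k b n

/-- The spectral norm of a matrix. -/
def specNorm {d : ℕ} {ι : Type} [Fintype ι] (M : Matrix ι (Fin d) ℝ) : ℝ :=
  ‖(Matrix.toEuclideanLin M).toContinuousLinearMap‖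

/-- The smallest nonzero singular value of a (nonzero) matrix. -/
def sigmaMin {d : ℕ} {ι : Type} [Fintype ι] (M : Matrix ι (Fin d) ℝ) : ℝ :=
  sInf {s : ℝ | s ≠ 0 ∧ ∃ j : ℕ, s = (Matrix.toEuclideanLin M).singularValues j}

/-- The largest index `i ≤ n` such that `B_{1:i}` has rank `k`. -/
def iStar {n d : ℕ} (k : ℕ) (b : Fin n → Pt d) : ℕ :=
  Nat.findGreatest (fun i => (prefixMatrix b i).rank = k) n

/-- The online rank-`k` condition number `‖B‖₂ / min_{i ≤ i* + 1} σ_min(B_{1:i})`; the minimum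
is over the prefixes that have a nonzero singular value. -/
def onlineCond {n d : ℕ} (k : ℕ) (b : Fin n → Pt d) : ℝ :=
  specNorm (rowsMatrix b Finset.univ) /
    sInf {s : ℝ | ∃ i : ℕ, 1 ≤ i ∧ i ≤ n ∧ i ≤ iStar k b + 1 ∧
      prefixMatrix b i ≠ 0 ∧ s = sigmaMin (prefixMatrix b i)}

end

end FlatFit

/-! Translating a flat so that it passes through the data point $a_1$ at most doubles the largest
distance to any set of points containing $a_1$. Flats for the $a_i$ can therefore be traded for
linear subspaces for the $b_i$ at a factor 2, and a coreset guarantee for subspaces passes to outer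
radii. This settles the first half.

For the second half it suffices that the streaming coreset has distortion $O(\sqrt
k\log(n\kappa'))$. If $b_t$ is rejected, test its score against $y$, the component of $b_t$
orthogonal to $V$: the energy $\|B_Sy\|^2$ is at most $\|y\|^2$ times the sum of squared distances
of the rows of $B_S$ to $V$, the ridge term at most $1/k$ of that, and the threshold $1/(1+1/k)$
cancels exactly. Hence $d(b_t,V)^2\le\sum_{i\in S}d(b_i,V)^2\le|S|\max_{i\in S}d(b_i,V)^2$, so the
distortion is at most $\sqrt{|S|}$ (`isStrongCoreset_streamingCoreset`).

It remains to show $|S|=O(k\log^2(n\kappa'))$. For a fixed ridge parameter $\mu$, each row of score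
at least $1/4$ multiplies $\det(B_J^TB_J+\mu I)$ by at least $5/4$. If the rows of $J$ have residual
$O(k\mu)$, this determinant is at most $\mu^d(1+L)^ke^{O(k)}$ with $L\ge\|B\|_F^2/\mu$, because all
but $k$ directions carry little mass. So one scale of $\mu$ accounts for $O(k\log(n\kappa'))$ rows
(`card_le_of_isHeavy`, `card_class_le`).

The algorithm's own ridge parameter varies. As long as the rank is at most $k$, the selected rows
span and dominate the prefix; when the rank first exceeds $k$, the residual jumps to at least
$\rho_0=\sigma^2/n$, where $\sigma$ is the denominator of $\kappa'$ (`coresetAfter_invariant`). It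
never exceeds $(n\kappa')^2\rho_0$, so positive residuals occupy $O(\log(n\kappa'))$ dyadic scales.
Rows selected at residual zero either raise the rank, at most $k+1$ times, or form one further class
with $\mu=\rho_0$.

If the rank of $B$ is at most $k$, all the radii vanish. -/

namespace FlatFit

open Module

/-! ### Flats, subspaces and radii -/

section Geometry

variable {n d k : ℕ}

theorem exists_le_finrank_eq {U : Submodule ℝ (Pt d)} (hU : finrank ℝ U ≤ k) (hk : k ≤ d) :
    ∃ V : Submodule ℝ (Pt d), U ≤ V ∧ finrank ℝ V = k := by
  induction k with
  | zero => exact ⟨U, le_rfl, by omega⟩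
  | succ k ih =>
    rcases Nat.lt_or_ge k (finrank ℝ U) with h | h
    · exact ⟨U, le_rfl, by omega⟩
    · obtain ⟨V, hUV, hV⟩ := ih h (by omega)
      obtain ⟨v, -, hv⟩ : ∃ v ∈ (⊤ : Submodule ℝ (Pt d)), v ∉ V := by
        refine SetLike.exists_of_lt (lt_top_iff_ne_top.2 ?_)
        rintro rfl
        rw [finrank_top, finrank_euclideanSpace_fin] at hV
        omega
      refine ⟨V ⊔ Submodule.span ℝ {v}, hUV.trans le_sup_left, ?_⟩
      rw [Submodule.finrank_sup_span_singleton hv, hV]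

theorem maxDist_nonneg (a : Fin n → Pt d) (S : Finset (Fin n)) (F : Set (Pt d)) :
    0 ≤ maxDist a S F :=
  Real.iSup_nonneg fun _ => Metric.infDist_nonneg

theorem infDist_le_maxDist (a : Fin n → Pt d) {S : Finset (Fin n)} (F : Set (Pt d)) {i : Fin n}
    (hi : i ∈ S) : Metric.infDist (a i) F ≤ maxDist a S F :=
  le_ciSup (f := fun i : S => Metric.infDist (a i) F) (Set.finite_range _).bddAbove ⟨i, hi⟩

theorem maxDist_le {a : Fin n → Pt d} {S : Finset (Fin n)} {F : Set (Pt d)} {r : ℝ} (hr : 0 ≤ r)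
    (h : ∀ i ∈ S, Metric.infDist (a i) F ≤ r) : maxDist a S F ≤ r :=
  Real.iSup_le (fun i => h i i.2) hr

theorem maxDist_mono (a : Fin n → Pt d) {S T : Finset (Fin n)} (h : S ⊆ T) (F : Set (Pt d)) :
    maxDist a S F ≤ maxDist a T F :=
  maxDist_le (maxDist_nonneg _ _ _) fun _ hi => infDist_le_maxDist a F (h hi)

theorem outerRadius_le (a : Fin n → Pt d) (S : Finset (Fin n)) {F : AffineSubspace ℝ (Pt d)}
    (hne : (F : Set (Pt d)).Nonempty) (hF : finrank ℝ F.direction = k) :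
    outerRadius k a S ≤ maxDist a S F :=
  csInf_le ⟨0, by rintro _ ⟨F, -, -, rfl⟩; exact maxDist_nonneg _ _ _⟩ ⟨F, hne, hF, rfl⟩

theorem subspaceRadius_le (a : Fin n → Pt d) (S : Finset (Fin n)) {V : Submodule ℝ (Pt d)}
    (hV : finrank ℝ V = k) : subspaceRadius k a S ≤ maxDist a S V :=
  csInf_le ⟨0, by rintro _ ⟨F, -, rfl⟩; exact maxDist_nonneg _ _ _⟩ ⟨V, hV, rfl⟩

theorem exists_finrank_eq (hk : k ≤ d) : ∃ V : Submodule ℝ (Pt d), finrank ℝ V = k := by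
  obtain ⟨V, -, hV⟩ := exists_le_finrank_eq (U := (⊥ : Submodule ℝ (Pt d))) (k := k) (by simp) hk
  exact ⟨V, hV⟩

theorem le_outerRadius (hk : k ≤ d) {a : Fin n → Pt d} {S : Finset (Fin n)} {r : ℝ}
    (h : ∀ F : AffineSubspace ℝ (Pt d), (F : Set (Pt d)).Nonempty →
      finrank ℝ F.direction = k → r ≤ maxDist a S F) : r ≤ outerRadius k a S := by
  apply le_csInf
  · obtain ⟨V, hV⟩ := exists_finrank_eq hk
    exact ⟨_, AffineSubspace.mk' 0 V, AffineSubspace.mk'_nonempty _ _,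
      by rw [AffineSubspace.direction_mk']; exact hV, rfl⟩
  · rintro _ ⟨F, h1, h2, rfl⟩
    exact h F h1 h2

theorem le_subspaceRadius (hk : k ≤ d) {a : Fin n → Pt d} {S : Finset (Fin n)} {r : ℝ}
    (h : ∀ V : Submodule ℝ (Pt d), finrank ℝ V = k → r ≤ maxDist a S V) :
    r ≤ subspaceRadius k a S := by
  apply le_csInf
  · obtain ⟨V, hV⟩ := exists_finrank_eq hk
    exact ⟨_, V, hV, rfl⟩
  · rintro _ ⟨V, h2, rfl⟩
    exact h V h2

theorem outerRadius_nonneg (a : Fin n → Pt d) (S : Finset (Fin n)) : 0 ≤ outerRadius k a S :=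
  Real.sInf_nonneg (by rintro _ ⟨F, -, -, rfl⟩; exact maxDist_nonneg _ _ _)

theorem subspaceRadius_nonneg (a : Fin n → Pt d) (S : Finset (Fin n)) :
    0 ≤ subspaceRadius k a S :=
  Real.sInf_nonneg (by rintro _ ⟨F, -, rfl⟩; exact maxDist_nonneg _ _ _)

theorem outerRadius_mono (hk : k ≤ d) (a : Fin n → Pt d) {S T : Finset (Fin n)} (h : S ⊆ T) :
    outerRadius k a S ≤ outerRadius k a T :=
  le_outerRadius hk fun F h1 h2 => (outerRadius_le a S h1 h2).trans (maxDist_mono a h F)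

/-- Moving a flat to pass through one of the points at most doubles the distances. -/
theorem maxDist_sub_direction_le (a : Fin n → Pt d) {S : Finset (Fin n)} {i₀ : Fin n}
    (h₀ : i₀ ∈ S) {F : AffineSubspace ℝ (Pt d)} (hne : (F : Set (Pt d)).Nonempty) :
    maxDist (fun i => a i - a i₀) S F.direction ≤ 2 * maxDist a S F := by
  refine maxDist_le (by have := maxDist_nonneg a S F; positivity) fun i hi => ?_
  -- Near-minimisers `y`, `z` replace nearest points; their difference lies in the direction of the
  -- flat.
  refine le_of_forall_pos_le_add fun ε hε => ?_
  obtain ⟨y, hy, hyd⟩ := (Metric.infDist_lt_iff (x := a i) hne).1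
    (lt_add_of_pos_right (Metric.infDist (a i) F) (half_pos hε))
  obtain ⟨z, hz, hzd⟩ := (Metric.infDist_lt_iff (x := a i₀) hne).1
    (lt_add_of_pos_right (Metric.infDist (a i₀) F) (half_pos hε))
  have h1 := infDist_le_maxDist a F hi
  have h2 := infDist_le_maxDist a F h₀
  have h3 : Metric.infDist (a i - a i₀) (F.direction : Set (Pt d)) ≤
      dist (a i - a i₀) (y - z) :=
    Metric.infDist_le_dist_of_mem (AffineSubspace.vsub_mem_direction hy hz)
  have h4 : dist (a i - a i₀) (y - z) ≤ dist (a i) y + dist (a i₀) z := dist_sub_sub_le _ _ _ _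
  linarith

theorem maxDist_mk' (a : Fin n → Pt d) (S : Finset (Fin n)) (p : Pt d)
    (V : Submodule ℝ (Pt d)) :
    maxDist a S (AffineSubspace.mk' p V) ≤ maxDist (fun i => a i - p) S V := by
  refine maxDist_le (maxDist_nonneg _ _ _) fun i hi => ?_
  refine le_trans ?_ (infDist_le_maxDist (fun i => a i - p) V hi)
  refine le_of_forall_pos_le_add fun ε hε => ?_
  obtain ⟨y, hy, hyd⟩ := (Metric.infDist_lt_iff (x := a i - p) V.nonempty).1
    (lt_add_of_pos_right (Metric.infDist (a i - p) V) hε)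
  have h3 : Metric.infDist (a i) (AffineSubspace.mk' p V : Set (Pt d)) ≤ dist (a i) (y + p) :=
    Metric.infDist_le_dist_of_mem (by simpa using hy)
  have h4 : dist (a i) (y + p) = dist (a i - p) y := by
    rw [dist_eq_norm, dist_eq_norm]; congr 1; abel
  linarith

variable [NeZero n]

theorem subspaceRadius_le_two_mul_outerRadius (hk : k ≤ d) (a : Fin n → Pt d)
    (S : Finset (Fin n)) :
    subspaceRadius k (fun i => a i - a 0) S ≤ 2 * outerRadius k a Finset.univ := by
  suffices h : subspaceRadius k (fun i => a i - a 0) S / 2 ≤ outerRadius k a Finset.univ by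
    linarith
  refine le_outerRadius hk fun F h1 h2 => ?_
  have h3 := maxDist_sub_direction_le a (Finset.mem_univ 0) h1
  have h4 := maxDist_mono (fun i => a i - a 0) (Finset.subset_univ S) F.direction
  have h5 := subspaceRadius_le (fun i => a i - a 0) S h2
  linarith

theorem outerRadius_univ_le (a : Fin n → Pt d) {V : Submodule ℝ (Pt d)} (hV : finrank ℝ V = k) :
    outerRadius k a Finset.univ ≤ maxDist (fun i => a i - a 0) Finset.univ V :=
  (outerRadius_le a _ (AffineSubspace.mk'_nonempty (a 0) V)
    (by rw [AffineSubspace.direction_mk']; exact hV)).trans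
    (maxDist_mk' a _ _ V)

/-- The direction of any flat serves as a test subspace for the coreset inequality. The base point
belongs to `insert 0 S`, so passing from the flat to its direction costs the factor 2; the bound
through linear subspaces needs no such factor. -/
theorem outerRadius_le_of_isStrongCoreset (hk : k ≤ d) (a : Fin n → Pt d) {S : Finset (Fin n)}
    {β : ℝ} (h : IsStrongCoreset k (fun i => a i - a 0) S β) :
    outerRadius k a Finset.univ ≤ 2 * β * outerRadius k a (insert 0 S) ∧
      outerRadius k a Finset.univ ≤ β * subspaceRadius k (fun i => a i - a 0) S := by
  set b : Fin n → Pt d := fun i => a i - a 0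
  -- No sign is imposed on `β`. If it is not positive, the coreset inequality forces every radius
  -- involved to be zero.
  rcases le_or_gt β 0 with hβ | hβ
  · obtain ⟨V, hV⟩ := exists_finrank_eq hk
    have h0 : outerRadius k a Finset.univ ≤ 0 :=
      (outerRadius_univ_le a hV).trans ((h V hV).2.trans
        (mul_nonpos_of_nonpos_of_nonneg hβ (maxDist_nonneg _ _ _)))
    have h1 := outerRadius_mono hk a (Finset.subset_univ (insert 0 S))
    have h2 := outerRadius_nonneg (k := k) a (insert 0 S)
    have h3 := subspaceRadius_nonneg (k := k) b S
    have h4 := subspaceRadius_le_two_mul_outerRadius hk a S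
    have h5 : outerRadius k a (insert 0 S) = 0 := by linarith
    have h6 : subspaceRadius k b S = 0 := by linarith
    rw [h5, h6]
    simpa using h0
  · constructor
    · rw [← div_le_iff₀' (by positivity)]
      refine le_outerRadius hk fun F h1 h2 => ?_
      rw [div_le_iff₀' (by positivity)]
      calc _ ≤ maxDist b Finset.univ F.direction := outerRadius_univ_le a h2
        _ ≤ β * maxDist b S F.direction := (h _ h2).2
        _ ≤ β * (2 * maxDist a (insert 0 S) F) := by
          gcongr
          exact (maxDist_mono b (Finset.subset_insert _ _) _).trans
            (maxDist_sub_direction_le a (Finset.mem_insert_self _ _) h1)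
        _ = _ := by ring
    · rw [← div_le_iff₀' hβ]
      refine le_subspaceRadius hk fun V hV => ?_
      rw [div_le_iff₀' hβ]
      exact (outerRadius_univ_le a hV).trans (h V hV).2

theorem outerRadius_univ_eq_zero (hk : k ≤ d) (a : Fin n → Pt d)
    (h : finrank ℝ (Submodule.span ℝ (Set.range fun i => a i - a 0)) ≤ k) :
    outerRadius k a Finset.univ = 0 := by
  obtain ⟨V, hUV, hV⟩ := exists_le_finrank_eq h hk
  refine le_antisymm ((outerRadius_univ_le a hV).trans (maxDist_le le_rfl fun i _ => ?_))
    (outerRadius_nonneg _ _)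
  exact (Metric.infDist_zero_of_mem (hUV (Submodule.subset_span ⟨i, rfl⟩))).le

end Geometry

end FlatFit

namespace FlatFit

open Module

local notation "⟪" x ", " y "⟫" => inner ℝ x y

/-! ### Energy, squared distances and the rank-`k` residual -/

section Residual

variable {n d k : ℕ}

/-- `‖B_S x‖²`. -/
noncomputable def energy (b : Fin n → Pt d) (S : Finset (Fin n)) (x : Pt d) : ℝ :=
  ∑ i ∈ S, ⟪b i, x⟫ ^ 2

/-- The row space of `B_S`. -/
def rowSpace (b : Fin n → Pt d) (S : Finset (Fin n)) : Submodule ℝ (Pt d) :=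
  Submodule.span ℝ (b '' (S : Set (Fin n)))

/-- The sum of the squared distances of the rows of `B_S` to `V`. -/
noncomputable def sqDist (b : Fin n → Pt d) (S : Finset (Fin n)) (V : Submodule ℝ (Pt d)) : ℝ :=
  ∑ i ∈ S, ‖b i - V.starProjection (b i)‖ ^ 2

/-- `‖B_S - [B_S]_k‖_F²`. -/
noncomputable def residual (k : ℕ) (b : Fin n → Pt d) (S : Finset (Fin n)) : ℝ :=
  rankResidualSq k (rowsMatrix b S)

theorem energy_nonneg (b : Fin n → Pt d) (S : Finset (Fin n)) (x : Pt d) : 0 ≤ energy b S x :=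
  Finset.sum_nonneg fun _ _ => sq_nonneg _

theorem energy_mono (b : Fin n → Pt d) {S T : Finset (Fin n)} (h : S ⊆ T) (x : Pt d) :
    energy b S x ≤ energy b T x :=
  Finset.sum_le_sum_of_subset_of_nonneg h fun _ _ _ => sq_nonneg _

theorem energy_insert (b : Fin n → Pt d) {S : Finset (Fin n)} {t : Fin n} (h : t ∉ S)
    (x : Pt d) : energy b (insert t S) x = ⟪b t, x⟫ ^ 2 + energy b S x :=
  Finset.sum_insert h

theorem mem_rowSpace (b : Fin n → Pt d) {S : Finset (Fin n)} {i : Fin n} (h : i ∈ S) :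
    b i ∈ rowSpace b S :=
  Submodule.subset_span ⟨i, h, rfl⟩

theorem rowSpace_mono (b : Fin n → Pt d) {S T : Finset (Fin n)} (h : S ⊆ T) :
    rowSpace b S ≤ rowSpace b T :=
  Submodule.span_mono (Set.image_mono (by exact_mod_cast h))

theorem rowSpace_insert (b : Fin n → Pt d) (S : Finset (Fin n)) (t : Fin n) :
    rowSpace b (insert t S) = rowSpace b S ⊔ Submodule.span ℝ {b t} := by
  rw [rowSpace, Finset.coe_insert, Set.image_insert_eq, Submodule.span_insert, sup_comm]
  rfl

theorem inner_eq_zero_of_energy_eq_zero {b : Fin n → Pt d} {S : Finset (Fin n)} {x y : Pt d}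
    (h : energy b S x = 0) (hy : y ∈ rowSpace b S) : ⟪y, x⟫ = 0 := by
  have h4 := (Finset.sum_eq_zero_iff_of_nonneg fun _ _ => sq_nonneg _).1 h
  have h5 : rowSpace b S ≤ (Submodule.span ℝ {x})ᗮ := by
    rw [rowSpace, Submodule.span_le]
    rintro _ ⟨i, hi, rfl⟩
    rw [SetLike.mem_coe, Submodule.mem_orthogonal_singleton_iff_inner_left]
    exact pow_eq_zero_iff (two_ne_zero) |>.1 (h4 i hi)
  exact Submodule.mem_orthogonal_singleton_iff_inner_left.1 (h5 hy)

theorem sqDist_nonneg (b : Fin n → Pt d) (S : Finset (Fin n)) (V : Submodule ℝ (Pt d)) :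
    0 ≤ sqDist b S V :=
  Finset.sum_nonneg fun _ _ => sq_nonneg _

theorem sqDist_mono (b : Fin n → Pt d) {S T : Finset (Fin n)} (h : S ⊆ T)
    (V : Submodule ℝ (Pt d)) : sqDist b S V ≤ sqDist b T V :=
  Finset.sum_le_sum_of_subset_of_nonneg h fun _ _ _ => sq_nonneg _

theorem norm_sub_starProjection_le (V : Submodule ℝ (Pt d)) (x : Pt d) {y : Pt d} (hy : y ∈ V) :
    ‖x - V.starProjection x‖ ≤ ‖x - y‖ := by
  rw [Submodule.starProjection_minimal]
  exact ciInf_le (f := fun y : V => ‖x - y‖) ⟨0, by rintro _ ⟨_, rfl⟩; positivity⟩ ⟨y, hy⟩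

theorem infDist_eq_norm_sub_starProjection (V : Submodule ℝ (Pt d)) (x : Pt d) :
    Metric.infDist x V = ‖x - V.starProjection x‖ := by
  rw [Metric.infDist_eq_iInf, Submodule.starProjection_minimal]
  simp only [dist_eq_norm]
  rfl

/-- `B_S` is small on the orthogonal complement of a subspace which is close to its rows. -/
theorem energy_le_sqDist_mul {b : Fin n → Pt d} {S : Finset (Fin n)} {V : Submodule ℝ (Pt d)}
    {x : Pt d} (hx : x ∈ Vᗮ) : energy b S x ≤ sqDist b S V * ‖x‖ ^ 2 := by
  rw [energy, sqDist, Finset.sum_mul]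
  refine Finset.sum_le_sum fun i _ => ?_
  have h : ⟪b i, x⟫ = ⟪b i - V.starProjection (b i), x⟫ := by
    rw [inner_sub_left, (Submodule.mem_orthogonal V x).1 hx _
      (Submodule.starProjection_apply_mem V _), sub_zero]
  rw [h, ← mul_pow, ← sq_abs]
  gcongr
  exact abs_real_inner_le_norm _ _

theorem rank_rowsMatrix (b : Fin n → Pt d) (S : Finset (Fin n)) :
    (rowsMatrix b S).rank = finrank ℝ (rowSpace b S) := by
  have h : Set.range (rowsMatrix b S).row =
      ((WithLp.linearEquiv 2 ℝ (Fin d → ℝ) : Pt d →ₗ[ℝ] Fin d → ℝ) : Pt d → Fin d → ℝ) ''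
        (b '' (S : Set (Fin n))) := by
    ext v
    constructor
    · rintro ⟨i, rfl⟩
      exact ⟨b i, ⟨i, i.2, rfl⟩, rfl⟩
    · rintro ⟨_, ⟨i, hi, rfl⟩, rfl⟩
      exact ⟨⟨i, hi⟩, rfl⟩
  rw [Matrix.rank_eq_finrank_span_row,
    ← LinearEquiv.finrank_map_eq (WithLp.linearEquiv 2 ℝ (Fin d → ℝ)) (rowSpace b S), rowSpace,
    Submodule.map_span, h]

theorem rankResidualSq_bddBelow {ι : Type} [Fintype ι] (k : ℕ) (M : Matrix ι (Fin d) ℝ) :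
    BddBelow {r : ℝ | ∃ N : Matrix ι (Fin d) ℝ, N.rank ≤ k ∧
      r = ∑ i, ∑ j, (M i j - N i j) ^ 2} :=
  ⟨0, by rintro _ ⟨N, -, rfl⟩; positivity⟩

theorem residual_nonneg (k : ℕ) (b : Fin n → Pt d) (S : Finset (Fin n)) : 0 ≤ residual k b S :=
  Real.sInf_nonneg (by rintro _ ⟨N, -, rfl⟩; positivity)

theorem residual_le_sqDist (b : Fin n → Pt d) (S : Finset (Fin n)) {V : Submodule ℝ (Pt d)}
    (hV : finrank ℝ V ≤ k) : residual k b S ≤ sqDist b S V := by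
  refine csInf_le (rankResidualSq_bddBelow _ _)
    ⟨rowsMatrix (fun i => V.starProjection (b i)) S, ?_, ?_⟩
  · rw [rank_rowsMatrix]
    refine (Submodule.finrank_mono ?_).trans hV
    rw [rowSpace, Submodule.span_le]
    rintro _ ⟨i, -, rfl⟩
    exact Submodule.starProjection_apply_mem V _
  · rw [sqDist, ← Finset.sum_coe_sort]
    refine Finset.sum_congr rfl fun i _ => ?_
    rw [EuclideanSpace.real_norm_sq_eq]
    rfl

/-- With `residual_le_sqDist`, this identifies the residual as an infimum over subspaces instead of
matrices: given a competitor `N`, projecting onto its row space is at least as good. Working with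
strict bounds avoids proving that the infimum is attained. -/
theorem exists_sqDist_lt {b : Fin n → Pt d} {S : Finset (Fin n)} {r : ℝ}
    (h : residual k b S < r) :
    ∃ V : Submodule ℝ (Pt d), finrank ℝ V ≤ k ∧ sqDist b S V < r := by
  have hne : {r : ℝ | ∃ N : Matrix S (Fin d) ℝ, N.rank ≤ k ∧
      r = ∑ i, ∑ j, (rowsMatrix b S i j - N i j) ^ 2}.Nonempty := ⟨_, 0, by simp, rfl⟩
  obtain ⟨_, ⟨N, hN, rfl⟩, hr⟩ := exists_lt_of_csInf_lt hne h
  rw [Matrix.rank_eq_finrank_span_row,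
    ← LinearEquiv.finrank_map_eq (WithLp.linearEquiv 2 ℝ (Fin d → ℝ)).symm] at hN
  refine ⟨_, hN, lt_of_le_of_lt ?_ hr⟩
  rw [sqDist, ← Finset.sum_coe_sort]
  refine Finset.sum_le_sum fun i _ => ?_
  have h1 := norm_sub_starProjection_le ((Submodule.span ℝ (Set.range N.row)).map
    ((WithLp.linearEquiv 2 ℝ (Fin d → ℝ)).symm : (Fin d → ℝ) →ₗ[ℝ] Pt d)) (b i)
    (Submodule.mem_map_of_mem (Submodule.subset_span ⟨i, rfl⟩))
  refine (pow_le_pow_left₀ (norm_nonneg _) h1 2).trans (le_of_eq ?_)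
  rw [EuclideanSpace.real_norm_sq_eq]
  rfl

theorem residual_mono (b : Fin n → Pt d) {S T : Finset (Fin n)} (h : S ⊆ T) :
    residual k b S ≤ residual k b T := by
  refine le_of_forall_gt fun r hr => ?_
  obtain ⟨V, hV, hlt⟩ := exists_sqDist_lt hr
  exact (residual_le_sqDist b S hV).trans_lt ((sqDist_mono b h V).trans_lt hlt)

theorem residual_eq_zero {b : Fin n → Pt d} {S : Finset (Fin n)}
    (h : finrank ℝ (rowSpace b S) ≤ k) : residual k b S = 0 := by
  refine le_antisymm ((residual_le_sqDist b S h).trans (le_of_eq ?_)) (residual_nonneg _ _ _)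
  refine Finset.sum_eq_zero fun i hi => ?_
  rw [Submodule.starProjection_eq_self_iff.2 (mem_rowSpace b hi)]
  simp

theorem exists_mem_inf_orthogonal {U W : Submodule ℝ (Pt d)} (h : finrank ℝ W < finrank ℝ U) :
    ∃ x ∈ U, x ∈ Wᗮ ∧ x ≠ 0 := by
  have h1 := Submodule.finrank_add_finrank_orthogonal W
  have h2 := Submodule.finrank_sup_add_finrank_inf_eq U Wᗮ
  have h3 := Submodule.finrank_le (U ⊔ Wᗮ)
  have h4 : U ⊓ Wᗮ ≠ ⊥ := by
    intro h0
    rw [h0, finrank_bot] at h2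
    omega
  obtain ⟨x, hx, hx0⟩ := Submodule.exists_mem_ne_zero_of_ne_bot h4
  exact ⟨x, hx.1, hx.2, hx0⟩

/-- The Courant–Fischer argument: a subspace `W` of dimension at most `k` misses some direction of
`U`, and all the energy in that direction counts towards the squared distance to `W`. -/
theorem le_residual {b : Fin n → Pt d} {S : Finset (Fin n)} {U : Submodule ℝ (Pt d)} {c : ℝ}
    (hU : k < finrank ℝ U) (h : ∀ x ∈ U, c * ‖x‖ ^ 2 ≤ energy b S x) : c ≤ residual k b S := by
  by_contra! hlt
  obtain ⟨W, hW, hlt⟩ := exists_sqDist_lt hlt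
  obtain ⟨x, hxU, hxW, hx0⟩ := exists_mem_inf_orthogonal (hW.trans_lt hU)
  have h1 := (h x hxU).trans (energy_le_sqDist_mul hxW)
  have h2 : 0 < ‖x‖ ^ 2 := by positivity
  nlinarith

end Residual

end FlatFit

namespace FlatFit

open Module

local notation "⟪" x ", " y "⟫" => inner ℝ x y

/-! ### Cauchy–Schwarz for the Moore–Penrose pseudoinverse -/

section Pseudoinverse

variable {m : Type} [Fintype m] {M P : Matrix m m ℝ}

theorem IsMoorePenrose.transpose (hM : M.transpose = M) (h : IsMoorePenrose M P) :
    IsMoorePenrose M P.transpose where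
  mul_mul_self := by
    have := congrArg Matrix.transpose h.mul_mul_self
    rwa [Matrix.transpose_mul, Matrix.transpose_mul, hM, ← Matrix.mul_assoc] at this
  self_mul_mul := by
    have := congrArg Matrix.transpose h.self_mul_mul
    rwa [Matrix.transpose_mul, Matrix.transpose_mul, hM, ← Matrix.mul_assoc] at this
  symm_left := by
    have := h.symm_right
    rw [Matrix.transpose_mul, hM] at this
    rw [this, ← this, Matrix.transpose_mul, hM, Matrix.transpose_transpose, this]
  symm_right := by
    have := h.symm_left
    rw [Matrix.transpose_mul, hM] at this
    rw [this, ← this, Matrix.transpose_mul, hM, Matrix.transpose_transpose, this]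

theorem IsMoorePenrose.transpose_eq (hM : M.transpose = M) (h : IsMoorePenrose M P) :
    P.transpose = P :=
  (h.transpose hM).unique h

open Matrix in
theorem IsMoorePenrose.dotProduct_self (hM : M.transpose = M) (h : IsMoorePenrose M P)
    (b : m → ℝ) : (P *ᵥ b) ⬝ᵥ (M *ᵥ (P *ᵥ b)) = b ⬝ᵥ (P *ᵥ b) := by
  rw [mulVec_mulVec, dotProduct_comm, dotProduct_mulVec, ← mulVec_transpose, mulVec_mulVec,
    h.transpose_eq hM, ← Matrix.mul_assoc, h.self_mul_mul, dotProduct_comm]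

open Matrix in
-- For symmetric `M`, a vector orthogonal to the kernel lies in the range. Here the defect `w` is in
-- the kernel and is orthogonal to both of its terms, so it vanishes.
theorem IsMoorePenrose.mulVec_mulVec_eq (hM : M.transpose = M) (h : IsMoorePenrose M P)
    {b : m → ℝ} (hb : ∀ w, M *ᵥ w = 0 → w ⬝ᵥ b = 0) : M *ᵥ (P *ᵥ b) = b := by
  set w := b - M *ᵥ (P *ᵥ b) with hw
  have hMMP : M * (M * P) = M := by
    have h1 := h.symm_left
    rw [transpose_mul, hM, h.transpose_eq hM] at h1
    rw [← h1, ← Matrix.mul_assoc, h.mul_mul_self]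
  have h1 : M *ᵥ w = 0 := by
    rw [hw, mulVec_sub, mulVec_mulVec, mulVec_mulVec, Matrix.mul_assoc, hMMP, sub_self]
  have h2 : w ⬝ᵥ (M *ᵥ (P *ᵥ b)) = 0 := by
    rw [dotProduct_mulVec, ← mulVec_transpose, hM, h1, zero_dotProduct]
  have h3 : w ⬝ᵥ w = 0 := by
    conv_lhs => arg 2; rw [hw]
    rw [dotProduct_sub, hb w h1, h2, sub_zero]
  exact (sub_eq_zero.1 (dotProduct_self_eq_zero.1 h3)).symm

open Matrix in
theorem IsMoorePenrose.sq_dotProduct_le (hM : M.transpose = M)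
    (hpos : ∀ x, 0 ≤ x ⬝ᵥ (M *ᵥ x)) (h : IsMoorePenrose M P) {b : m → ℝ}
    (hb : ∀ w, M *ᵥ w = 0 → w ⬝ᵥ b = 0) (y : m → ℝ) :
    (b ⬝ᵥ y) ^ 2 ≤ (b ⬝ᵥ (P *ᵥ b)) * (y ⬝ᵥ (M *ᵥ y)) := by
  set x := P *ᵥ b with hx
  have hMx : M *ᵥ x = b := h.mulVec_mulVec_eq hM hb
  have h1 : x ⬝ᵥ (M *ᵥ y) = b ⬝ᵥ y := by
    rw [dotProduct_mulVec, ← mulVec_transpose, hM, hMx]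
  -- The form of `M` at `x + t • y` is a nonnegative quadratic in `t`; its discriminant gives the
  -- inequality.
  have key : ∀ t : ℝ, 0 ≤ (y ⬝ᵥ (M *ᵥ y)) * (t * t) + (2 * (b ⬝ᵥ y)) * t + b ⬝ᵥ x := by
    intro t
    have h0 := hpos (x + t • y)
    rw [mulVec_add, mulVec_smul, hMx] at h0
    simp only [add_dotProduct, dotProduct_add, smul_dotProduct, dotProduct_smul, h1,
      smul_eq_mul] at h0
    rw [dotProduct_comm x b, dotProduct_comm y b] at h0
    linarith
  have := discrim_le_zero key
  rw [discrim] at this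
  linarith

end Pseudoinverse

/-! ### Ridge leverage scores and rejected rows -/

section RidgeScore

variable {n d k : ℕ}

open Matrix

theorem inner_eq_dotProduct (x y : Pt d) : ⟪x, y⟫ = x.ofLp ⬝ᵥ y.ofLp := by
  rw [EuclideanSpace.inner_eq_star_dotProduct, dotProduct_comm]
  rfl

/-- The matrix `B_Sᵀ B_S + μ I`. -/
noncomputable def ridgeMatrix (b : Fin n → Pt d) (S : Finset (Fin n)) (μ : ℝ) :
    Matrix (Fin d) (Fin d) ℝ :=
  (rowsMatrix b S)ᵀ * rowsMatrix b S + μ • (1 : Matrix (Fin d) (Fin d) ℝ)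

theorem ridgeMatrix_transpose (b : Fin n → Pt d) (S : Finset (Fin n)) (μ : ℝ) :
    (ridgeMatrix b S μ)ᵀ = ridgeMatrix b S μ := by
  simp [ridgeMatrix, transpose_mul]

theorem rowsMatrix_mulVec (b : Fin n → Pt d) (S : Finset (Fin n)) (x : Fin d → ℝ) (i : S) :
    (rowsMatrix b S *ᵥ x) i = (b i).ofLp ⬝ᵥ x := rfl

theorem dotProduct_ridgeMatrix_mulVec (b : Fin n → Pt d) (S : Finset (Fin n)) (μ : ℝ)
    (x : Pt d) :
    x.ofLp ⬝ᵥ (ridgeMatrix b S μ *ᵥ x.ofLp) = energy b S x + μ * ‖x‖ ^ 2 := by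
  rw [ridgeMatrix, add_mulVec, smul_mulVec, one_mulVec, dotProduct_add, dotProduct_smul,
    ← inner_eq_dotProduct x x, real_inner_self_eq_norm_sq, ← mulVec_mulVec, dotProduct_mulVec,
    vecMul_transpose, smul_eq_mul, energy, ← Finset.sum_coe_sort]
  congr 1
  refine Finset.sum_congr rfl fun i _ => ?_
  rw [rowsMatrix_mulVec, inner_eq_dotProduct, sq]

theorem ridgeParam_nonneg (k : ℕ) (b : Fin n → Pt d) (S : Finset (Fin n)) :
    0 ≤ ridgeParam k b S :=
  div_nonneg (residual_nonneg _ _ _) (Nat.cast_nonneg _)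

theorem isMoorePenrose_ridgeMatrix (b : Fin n → Pt d) (S : Finset (Fin n)) (μ : ℝ) :
    IsMoorePenrose (ridgeMatrix b S μ) (pinv (ridgeMatrix b S μ)) :=
  isMoorePenrose_pinv _ (by
    rw [IsHermitian, conjTranspose_eq_transpose_of_trivial, ridgeMatrix_transpose])

theorem ridgeScore_eq (b : Fin n → Pt d) (S : Finset (Fin n)) (t : Fin n) :
    ridgeScore k b S t =
      (b t).ofLp ⬝ᵥ (pinv (ridgeMatrix b S (ridgeParam k b S)) *ᵥ (b t).ofLp) := rfl

/-- A large score is witnessed by a direction. -/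
theorem exists_of_le_ridgeScore {b : Fin n → Pt d} {S : Finset (Fin n)} {t : Fin n} {s : ℝ}
    (hs : 0 < s) (h : s ≤ ridgeScore k b S t) :
    ∃ x, s * (energy b S x + ridgeParam k b S * ‖x‖ ^ 2) ≤ ⟪b t, x⟫ ^ 2 ∧ ⟪b t, x⟫ ≠ 0 := by
  set M := ridgeMatrix b S (ridgeParam k b S) with hM
  have h1 := (isMoorePenrose_ridgeMatrix b S (ridgeParam k b S)).dotProduct_self
    (ridgeMatrix_transpose _ _ _) (b t).ofLp
  rw [← ridgeScore_eq] at h1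
  refine ⟨WithLp.toLp 2 (pinv M *ᵥ (b t).ofLp), ?_, ?_⟩
  · rw [← dotProduct_ridgeMatrix_mulVec, inner_eq_dotProduct]
    change s * ((pinv M *ᵥ (b t).ofLp) ⬝ᵥ (M *ᵥ (pinv M *ᵥ (b t).ofLp))) ≤ ridgeScore k b S t ^ 2
    rw [h1]
    nlinarith
  · rw [inner_eq_dotProduct]
    exact (hs.trans_le h).ne'

/-- The hypothesis is what puts `b t` orthogonal to the kernel of the ridge matrix: either the
kernel is trivial, or it consists of vectors orthogonal to the row space. Failure of the first
selection test supplies precisely this alternative. -/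
theorem sq_inner_le_ridgeScore_mul {b : Fin n → Pt d} {S : Finset (Fin n)} {t : Fin n}
    (h : 0 < ridgeParam k b S ∨ b t ∈ rowSpace b S) (y : Pt d) :
    ⟪b t, y⟫ ^ 2 ≤ ridgeScore k b S t * (energy b S y + ridgeParam k b S * ‖y‖ ^ 2) := by
  have hnn := ridgeParam_nonneg k b S
  have hform := dotProduct_ridgeMatrix_mulVec b S (ridgeParam k b S)
  rw [← hform, inner_eq_dotProduct, ridgeScore_eq]
  refine (isMoorePenrose_ridgeMatrix b S _).sq_dotProduct_le (ridgeMatrix_transpose _ _ _)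
    (fun x => ?_) (fun w hw => ?_) _
  · have h1 := hform (WithLp.toLp 2 x)
    rw [WithLp.ofLp_toLp] at h1
    rw [h1]
    have := energy_nonneg b S (WithLp.toLp 2 x)
    positivity
  · have h1 := hform (WithLp.toLp 2 w)
    rw [WithLp.ofLp_toLp, hw, dotProduct_zero] at h1
    have h2 := energy_nonneg b S (WithLp.toLp 2 w)
    rcases h with h | h
    · have h3 : ‖(WithLp.toLp 2 w : Pt d)‖ ^ 2 = 0 := by
        by_contra h0
        have : 0 < ‖(WithLp.toLp 2 w : Pt d)‖ ^ 2 := lt_of_le_of_ne (sq_nonneg _) (Ne.symm h0)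
        nlinarith
      have h4 : (WithLp.toLp 2 w : Pt d) = 0 := by simpa using h3
      have h5 : w = 0 := congrArg WithLp.ofLp h4
      rw [h5, zero_dotProduct]
    · have h3 : energy b S (WithLp.toLp 2 w) = 0 := by
        have : 0 ≤ ridgeParam k b S * ‖(WithLp.toLp 2 w : Pt d)‖ ^ 2 := by positivity
        linarith
      have h4 := inner_eq_zero_of_energy_eq_zero h3 h
      rw [real_inner_comm, inner_eq_dotProduct] at h4
      exact h4

theorem sq_inner_le_of_not_selects {b : Fin n → Pt d} {S : Finset (Fin n)}
    {t : Fin n} (h : ¬ Selects k b S t) (y : Pt d) :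
    ⟪b t, y⟫ ^ 2 ≤ 1 / (1 + 1 / (k : ℝ)) * (energy b S y + ridgeParam k b S * ‖y‖ ^ 2) := by
  rw [Selects, not_or, not_and_or, not_not, not_le] at h
  have h1 := ridgeParam_nonneg k b S
  refine (sq_inner_le_ridgeScore_mul (k := k) (S := S) ?_ y).trans ?_
  · exact h.1.imp (fun h0 => lt_of_le_of_ne h1 (Ne.symm h0)) id
  · have := energy_nonneg b S y
    have : 0 ≤ energy b S y + ridgeParam k b S * ‖y‖ ^ 2 := by positivity
    exact mul_le_mul_of_nonneg_right h.2.le this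

/-- A row which is not selected is covered by the selected ones. -/
theorem norm_sub_starProjection_sq_le_of_not_selects (hk : 1 ≤ k) {b : Fin n → Pt d}
    {S : Finset (Fin n)} {t : Fin n} (h : ¬ Selects k b S t) {V : Submodule ℝ (Pt d)}
    (hV : finrank ℝ V = k) : ‖b t - V.starProjection (b t)‖ ^ 2 ≤ sqDist b S V := by
  set y := b t - V.starProjection (b t) with hy
  have hyV : y ∈ Vᗮ := Submodule.sub_starProjection_mem_orthogonal _
  have h1 : ⟪b t, y⟫ = ‖y‖ ^ 2 := by
    rw [← real_inner_self_eq_norm_sq]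
    conv_rhs => arg 2; rw [hy]
    rw [inner_sub_left, (Submodule.mem_orthogonal V y).1 hyV _
      (Submodule.starProjection_apply_mem V _), sub_zero]
  have h2 := sq_inner_le_of_not_selects h y
  have h3 := energy_le_sqDist_mul (b := b) (S := S) hyV
  have h4 : ridgeParam k b S ≤ sqDist b S V / k :=
    div_le_div_of_nonneg_right (residual_le_sqDist b S hV.le) (Nat.cast_nonneg _)
  have hk0 : (0 : ℝ) < k := by exact_mod_cast hk
  have h5 : (‖y‖ ^ 2) ^ 2 ≤ sqDist b S V * ‖y‖ ^ 2 := by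
    calc (‖y‖ ^ 2) ^ 2 = ⟪b t, y⟫ ^ 2 := by rw [h1]
      _ ≤ _ := h2
      _ ≤ 1 / (1 + 1 / (k : ℝ)) *
          (sqDist b S V * ‖y‖ ^ 2 + sqDist b S V / k * ‖y‖ ^ 2) := by gcongr
      -- The threshold cancels the factor `1 + 1/k` exactly.
      _ = _ := by field_simp
  rcases (sq_nonneg ‖y‖).eq_or_lt with h0 | h0
  · rw [← h0]
    exact sqDist_nonneg _ _ _
  · rw [sq (‖y‖ ^ 2)] at h5
    exact le_of_mul_le_mul_right h5 h0

end RidgeScore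

end FlatFit

namespace FlatFit

open Module Matrix

local notation "⟪" x ", " y "⟫" => inner ℝ x y

/-! ### Determinant inequalities -/

section Determinant

variable {m : Type} [Fintype m] [DecidableEq m]

theorem isMoorePenrose_inv {X : Matrix m m ℝ} (hX : IsUnit X.det) : IsMoorePenrose X X⁻¹ where
  mul_mul_self := by rw [mul_nonsing_inv _ hX, one_mul]
  self_mul_mul := by rw [nonsing_inv_mul _ hX, one_mul]
  symm_left := by rw [mul_nonsing_inv _ hX, transpose_one]
  symm_right := by rw [nonsing_inv_mul _ hX, transpose_one]

/-- A rank-one update with a large leverage score increases the determinant by a factor. -/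
theorem mul_det_le_det_add_vecMulVec {X : Matrix m m ℝ} (hX : X.PosDef) {v x : m → ℝ} {s : ℝ}
    (h : s * (x ⬝ᵥ (X *ᵥ x)) ≤ (v ⬝ᵥ x) ^ 2) (h0 : v ⬝ᵥ x ≠ 0) :
    (1 + s) * X.det ≤ (X + vecMulVec v v).det := by
  have hu : IsUnit X.det := hX.det_pos.ne'.isUnit
  have hpos : ∀ y, 0 ≤ y ⬝ᵥ (X *ᵥ y) := fun y => by
    simpa using hX.posSemidef.dotProduct_mulVec_nonneg y
  have hT : Xᵀ = X := by
    simpa [conjTranspose_eq_transpose_of_trivial] using hX.isHermitian.eq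
  have h1 : (v ⬝ᵥ x) ^ 2 ≤ (v ⬝ᵥ (X⁻¹ *ᵥ v)) * (x ⬝ᵥ (X *ᵥ x)) :=
    (isMoorePenrose_inv hu).sq_dotProduct_le hT hpos (fun w hw => by
      have : w = 0 := by
        have h2 := congrArg (X⁻¹ *ᵥ ·) hw
        simpa [mulVec_mulVec, nonsing_inv_mul _ hu] using h2
      rw [this, zero_dotProduct]) x
  have h2 : s ≤ v ⬝ᵥ (X⁻¹ *ᵥ v) := by
    have h3 : 0 < (v ⬝ᵥ x) ^ 2 := by positivity
    have h4 : 0 < x ⬝ᵥ (X *ᵥ x) := by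
      refine lt_of_le_of_ne (hpos x) fun h4 => ?_
      rw [← h4, mul_zero] at h1
      linarith
    exact le_of_mul_le_mul_right (h.trans h1) h4
  have h3 : (1 + replicateRow Unit v * X⁻¹ * replicateCol Unit v).det =
      1 + v ⬝ᵥ (X⁻¹ *ᵥ v) := by
    rw [det_unique, Matrix.mul_assoc, ← replicateCol_mulVec]
    rfl
  rw [vecMulVec_eq Unit, det_add_replicateCol_mul_replicateRow hu, h3, mul_comm]
  have := hX.det_pos.le
  gcongr

/-- Each eigenvalue satisfies $\lambda\le e^{\lambda-1}$. -/
theorem det_le_exp_trace_sub {Z : Matrix m m ℝ} (hZ : Z.PosSemidef) :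
    Z.det ≤ Real.exp (Z.trace - Fintype.card m) := by
  rw [hZ.isHermitian.det_eq_prod_eigenvalues, hZ.isHermitian.trace_eq_sum_eigenvalues]
  have : ∑ i, hZ.isHermitian.eigenvalues i - Fintype.card m =
      ∑ i, (hZ.isHermitian.eigenvalues i - 1) := by
    simp
  simp only [RCLike.ofReal_real_eq_id, id]
  rw [this, Real.exp_sum]
  refine Finset.prod_le_prod (fun i _ => hZ.eigenvalues_nonneg i) fun i _ => ?_
  have := Real.add_one_le_exp (hZ.isHermitian.eigenvalues i - 1)
  linarith

/-- A determinant bound from the traces of the compressions of `X` to a subspace, with orthonormal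
basis the rows of `Q`, and to its orthogonal complement. -/
theorem det_le_of_trace {r : ℕ} {X : Matrix m m ℝ} (hX : X.PosSemidef) {Q : Matrix (Fin r) m ℝ}
    (hQ : Q * Qᵀ = 1) {L : ℝ} (hL : 0 ≤ L) :
    X.det ≤ (1 + L) ^ r *
      Real.exp (X.trace - L / (1 + L) * (Q * X * Qᵀ).trace - Fintype.card m) := by
  have hL1 : 0 < 1 + L := by positivity
  -- With this `c`, the matrix `T` scales the span of the rows of `Q` by $(1+L)^{-1/2}$ and fixes
  -- its complement. The trace bound is then applied to `T * X * T`, in which the few large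
  -- directions have been damped.
  set c : ℝ := 1 - (√(1 + L))⁻¹ with hc
  have hsq : ((√(1 + L))⁻¹) ^ 2 = (1 + L)⁻¹ := by
    rw [inv_pow, Real.sq_sqrt hL1.le]
  set T : Matrix m m ℝ := 1 - c • (Qᵀ * Q) with hT
  have hTT : Tᵀ = T := by simp [hT, transpose_mul]
  have hdet : T.det = ((√(1 + L))⁻¹) ^ r := by
    rw [hT, ← Matrix.smul_mul, det_one_sub_mul_comm, Matrix.mul_smul, hQ]
    have : (1 : Matrix (Fin r) (Fin r) ℝ) - c • 1 = (√(1 + L))⁻¹ • 1 := by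
      rw [hc, sub_smul, one_smul, sub_sub_cancel]
    rw [this, det_smul, det_one, mul_one, Fintype.card_fin]
  have hT2 : T * T = 1 - (L / (1 + L)) • (Qᵀ * Q) := by
    have h1 : (Qᵀ * Q) * (Qᵀ * Q) = Qᵀ * Q := by
      rw [Matrix.mul_assoc, ← Matrix.mul_assoc Q, hQ, Matrix.one_mul]
    have h2 : T * T = 1 - (2 * c - c ^ 2) • (Qᵀ * Q) := by
      rw [hT, sub_mul, mul_sub, mul_sub, Matrix.smul_mul, Matrix.smul_mul,
      Matrix.mul_smul, Matrix.mul_smul, h1, Matrix.one_mul, Matrix.mul_one,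
        Matrix.one_mul]
      module
    rw [h2]
    congr 2
    have : 2 * c - c ^ 2 = 1 - ((√(1 + L))⁻¹) ^ 2 := by rw [hc]; ring
    rw [this, hsq]
    field_simp
    ring
  have hpsd : (T * X * T).PosSemidef := by
    have := hX.conjTranspose_mul_mul_same T
    rwa [conjTranspose_eq_transpose_of_trivial, hTT] at this
  have htr : (T * X * T).trace = X.trace - L / (1 + L) * (Q * X * Qᵀ).trace := by
    rw [trace_mul_comm, ← Matrix.mul_assoc, hT2, sub_mul, Matrix.one_mul, trace_sub, Matrix.smul_mul,
      trace_smul, smul_eq_mul, Matrix.mul_assoc, trace_mul_comm]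
  have h := det_le_exp_trace_sub hpsd
  rw [det_mul, det_mul, hdet, htr] at h
  have h3 : ((√(1 + L))⁻¹) ^ r * X.det * ((√(1 + L))⁻¹) ^ r = X.det / (1 + L) ^ r := by
    rw [mul_right_comm, ← mul_pow, ← sq, hsq, inv_pow, mul_comm, div_eq_mul_inv]
  rw [h3, div_le_iff₀ (by positivity)] at h
  linarith

end Determinant

/-! ### The determinant as a potential for counting heavy rows -/

section Potential

variable {n d k : ℕ}

/-- The ridge leverage score of `b_t` relative to `B_S`, with parameter `μ`, is at least `s`. -/
def IsHeavy (s μ : ℝ) (b : Fin n → Pt d) (S : Finset (Fin n)) (t : Fin n) : Prop :=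
  ∃ x, s * (energy b S x + μ * ‖x‖ ^ 2) ≤ ⟪b t, x⟫ ^ 2 ∧ ⟪b t, x⟫ ≠ 0

/-- Heaviness survives discarding rows and shrinking `μ`, so rows selected against the full coreset
remain heavy inside a subclass with a common parameter. -/
theorem IsHeavy.mono {s s' μ μ' : ℝ} {b : Fin n → Pt d} {S S' : Finset (Fin n)} {t : Fin n}
    (h : IsHeavy s μ b S t) (hs : 0 ≤ s') (hs' : s' ≤ s) (hμ : 0 ≤ μ') (hμ' : μ' ≤ μ)
    (hS : S' ⊆ S) : IsHeavy s' μ' b S' t := by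
  obtain ⟨x, h1, h2⟩ := h
  refine ⟨x, le_trans ?_ h1, h2⟩
  have := energy_mono b hS x
  have := energy_nonneg b S' x
  have := hs.trans hs'
  gcongr

theorem ridgeMatrix_posDef (b : Fin n → Pt d) (S : Finset (Fin n)) {μ : ℝ} (hμ : 0 < μ) :
    (ridgeMatrix b S μ).PosDef := by
  refine PosDef.of_dotProduct_mulVec_pos ?_ fun x hx => ?_
  · rw [IsHermitian, conjTranspose_eq_transpose_of_trivial, ridgeMatrix_transpose]
  · have h := dotProduct_ridgeMatrix_mulVec b S μ (WithLp.toLp 2 x)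
    rw [WithLp.ofLp_toLp] at h
    rw [star_trivial, h]
    have h1 := energy_nonneg b S (WithLp.toLp 2 x)
    have h2 : (WithLp.toLp 2 x : Pt d) ≠ 0 := fun h0 => hx (congrArg WithLp.ofLp h0)
    positivity

theorem gram_apply (b : Fin n → Pt d) (S : Finset (Fin n)) (i j : Fin d) :
    ((rowsMatrix b S)ᵀ * rowsMatrix b S) i j = ∑ t ∈ S, b t i * b t j := by
  rw [mul_apply]
  exact Finset.sum_coe_sort S fun t => b t i * b t j

theorem ridgeMatrix_insert (b : Fin n → Pt d) {S : Finset (Fin n)} {t : Fin n} (h : t ∉ S)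
    (μ : ℝ) : ridgeMatrix b (insert t S) μ =
      ridgeMatrix b S μ + vecMulVec (b t).ofLp (b t).ofLp := by
  ext i j
  simp only [ridgeMatrix, Matrix.add_apply, gram_apply, Finset.sum_insert h, vecMulVec_apply]
  ring

/-- Rows are added in stream order; each is heavy relative to its predecessors in `J`, so each
contributes a factor `1 + s`, starting from $\det(\mu I)=\mu^d$. -/
theorem pow_card_le_det_ridgeMatrix {b : Fin n → Pt d} {s μ : ℝ} (hs : 0 ≤ s) (hμ : 0 < μ)
    (J : Finset (Fin n)) (h : ∀ t ∈ J, IsHeavy s μ b (J.filter (· < t)) t) :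
    (1 + s) ^ J.card * μ ^ d ≤ (ridgeMatrix b J μ).det := by
  induction J using Finset.induction_on_max with
  | empty =>
    have : ridgeMatrix b ∅ μ = μ • 1 := by
      ext i j
      simp [ridgeMatrix, Matrix.add_apply, gram_apply]
    rw [this, det_smul]
    simp
  | insert a J ha ih =>
    have haJ : a ∉ J := fun h => lt_irrefl _ (ha a h)
    have hf : ∀ t ∈ J, (insert a J).filter (· < t) = J.filter (· < t) := fun t ht => by
      rw [Finset.filter_insert, if_neg (not_lt.2 (ha t ht).le)]
    have hfa : (insert a J).filter (· < a) = J := by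
      rw [Finset.filter_insert, if_neg (lt_irrefl _), Finset.filter_true_of_mem ha]
    have h1 := ih fun t ht => hf t ht ▸ h t (Finset.mem_insert_of_mem ht)
    obtain ⟨x, h2, h3⟩ := h a (Finset.mem_insert_self _ _)
    rw [hfa, ← dotProduct_ridgeMatrix_mulVec, inner_eq_dotProduct] at h2
    rw [inner_eq_dotProduct] at h3
    rw [Finset.card_insert_of_notMem haJ, ridgeMatrix_insert b haJ]
    refine le_trans ?_ (mul_det_le_det_add_vecMulVec (ridgeMatrix_posDef b J hμ) h2 h3)
    calc (1 + s) ^ (J.card + 1) * μ ^ d = (1 + s) * ((1 + s) ^ J.card * μ ^ d) := by ring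
      _ ≤ _ := by gcongr

theorem sum_energy_orthonormalBasis (b : Fin n → Pt d) (J : Finset (Fin n))
    {W : Submodule ℝ (Pt d)} {r : ℕ} (o : OrthonormalBasis (Fin r) ℝ W) :
    ∑ l, energy b J (o l : Pt d) = ∑ i ∈ J, ‖b i‖ ^ 2 - sqDist b J W := by
  simp only [energy, sqDist]
  rw [Finset.sum_comm, ← Finset.sum_sub_distrib]
  refine Finset.sum_congr rfl fun i _ => ?_
  have h1 := o.sum_sq_norm_inner_right (W.orthogonalProjectionOnto (b i))
  have h2 := W.norm_sq_eq_add_norm_sq_starProjection (b i)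
  have h3 : Wᗮ.starProjection (b i) = b i - W.starProjection (b i) := by
    rw [eq_sub_iff_add_eq, add_comm]
    exact W.starProjection_add_starProjection_orthogonal (b i)
  rw [h3] at h2
  have h4 : ‖W.starProjection (b i)‖ = ‖W.orthogonalProjectionOnto (b i)‖ := rfl
  rw [h2, h4, ← h1, add_sub_cancel_right]
  refine Finset.sum_congr rfl fun l _ => ?_
  rw [Real.norm_eq_abs, sq_abs, Submodule.inner_orthogonalProjectionOnto_eq_of_mem_left,
    real_inner_comm]

theorem trace_ridgeMatrix (b : Fin n → Pt d) (J : Finset (Fin n)) (μ : ℝ) :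
    (ridgeMatrix b J μ).trace = ∑ i ∈ J, ‖b i‖ ^ 2 + μ * d := by
  rw [ridgeMatrix, trace_add, trace_smul, trace_one, Fintype.card_fin, smul_eq_mul, trace]
  simp only [diag_apply, gram_apply]
  rw [Finset.sum_comm]
  congr 1
  refine Finset.sum_congr rfl fun i _ => ?_
  rw [EuclideanSpace.real_norm_sq_eq]
  exact Finset.sum_congr rfl fun j _ => (sq _).symm

/-- Only the at most `k` directions of `W` can carry large mass, each costing a factor `1 + L`; the
mass off `W` is `sqDist b J W` and enters through the exponential. -/
theorem det_ridgeMatrix_le {b : Fin n → Pt d} {J : Finset (Fin n)} {μ L : ℝ} (hμ : 0 < μ)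
    (hL : ∑ i ∈ J, ‖b i‖ ^ 2 ≤ L * μ) {W : Submodule ℝ (Pt d)} (hW : finrank ℝ W ≤ k) :
    (ridgeMatrix b J μ).det ≤ μ ^ d * ((1 + L) ^ k * Real.exp (sqDist b J W / μ)) := by
  set F := ∑ i ∈ J, ‖b i‖ ^ 2 with hF
  have hF0 : 0 ≤ F := Finset.sum_nonneg fun _ _ => sq_nonneg _
  have hL0 : 0 ≤ L := nonneg_of_mul_nonneg_left (hF0.trans hL) hμ
  set r := finrank ℝ W
  let o : OrthonormalBasis (Fin r) ℝ W := stdOrthonormalBasis ℝ W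
  let Q : Matrix (Fin r) (Fin d) ℝ := of fun l j => (o l : Pt d) j
  have hQ : Q * Qᵀ = 1 := by
    ext l l'
    have h1 : (Q * Qᵀ) l l' = ⟪(o l : Pt d), (o l' : Pt d)⟫ := by
      rw [inner_eq_dotProduct]; rfl
    have h2 := orthonormal_iff_ite.1 o.orthonormal l l'
    rw [h1, one_apply, ← h2]
    rfl
  set R := ridgeMatrix b J μ with hR
  have hX : (μ⁻¹ • R).PosSemidef :=
    (ridgeMatrix_posDef b J hμ).posSemidef.smul (inv_nonneg.2 hμ.le)
  have h := det_le_of_trace hX hQ hL0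
  have htr : (Q * R * Qᵀ).trace = F - sqDist b J W + μ * r := by
    rw [← sum_energy_orthonormalBasis b J o]
    have h1 : ∀ l, (Q * R * Qᵀ) l l = energy b J (o l : Pt d) + μ := fun l => by
      have h2 := dotProduct_ridgeMatrix_mulVec b J μ (o l : Pt d)
      have h3 : ‖(o l : Pt d)‖ = 1 := o.orthonormal.1 l
      rw [h3, one_pow, mul_one] at h2
      rw [← h2, Matrix.mul_assoc, mul_apply]
      rfl
    simp only [trace, diag_apply, h1, Finset.sum_add_distrib]
    simp [mul_comm]
  have hG : F - sqDist b J W ≤ r * F := by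
    rw [← sum_energy_orthonormalBasis b J o]
    have h1 : ∀ l ∈ Finset.univ, energy b J (o l : Pt d) ≤ F := fun l _ => by
      refine Finset.sum_le_sum fun i _ => ?_
      have h3 : ‖(o l : Pt d)‖ = 1 := o.orthonormal.1 l
      have h4 := abs_real_inner_le_norm (b i) (o l : Pt d)
      rw [h3, mul_one] at h4
      rw [← sq_abs]
      gcongr
    simpa using Finset.sum_le_card_nsmul _ _ _ h1
  rw [det_smul, Fintype.card_fin, trace_smul, Matrix.mul_smul, Matrix.smul_mul, trace_smul, htr,
    trace_ridgeMatrix, ← hF, inv_pow, inv_mul_le_iff₀ (by positivity), smul_eq_mul,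
    smul_eq_mul] at h
  refine h.trans ?_
  -- The slack is a multiple of $rL\mu-(F-\mathrm{sqDist})$. It is nonnegative because each of the
  -- `r` basis vectors of `W` has energy at most $F\le L\mu$.
  have hexp : μ⁻¹ * (F + μ * d) - L / (1 + L) * (μ⁻¹ * (F - sqDist b J W + μ * r)) - d ≤
      sqDist b J W / μ := by
    have h1 : F - sqDist b J W ≤ r * (L * μ) := hG.trans (by gcongr)
    have h2 : sqDist b J W / μ -
        (μ⁻¹ * (F + μ * d) - L / (1 + L) * (μ⁻¹ * (F - sqDist b J W + μ * r)) - d) =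
        (r * (L * μ) - (F - sqDist b J W)) / (μ * (1 + L)) := by
      field_simp
      ring
    have h3 : 0 ≤ (r * (L * μ) - (F - sqDist b J W)) / (μ * (1 + L)) :=
      div_nonneg (by linarith) (by positivity)
    linarith
  gcongr
  linarith

theorem one_div_five_le_log : (1 : ℝ) / 5 ≤ Real.log (1 + 1 / 4) := by
  have := Real.one_sub_inv_le_log_of_pos (x := (1 + 1 / 4 : ℝ)) (by norm_num)
  norm_num at this ⊢
  linarith

theorem exists_card_eq_card_filter_lt_add_one {J : Finset (Fin n)} (hJ : J.Nonempty) :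
    ∃ a ∈ J, J.card = (J.filter (· < a)).card + 1 := by
  have h : insert (J.max' hJ) (J.filter (· < J.max' hJ)) = J := by
    ext i
    simp only [Finset.mem_insert, Finset.mem_filter]
    constructor
    · rintro (rfl | h)
      exacts [J.max'_mem hJ, h.1]
    · intro h
      exact (J.le_max' i h).eq_or_lt.imp id fun h1 => ⟨h, h1⟩
  refine ⟨J.max' hJ, J.max'_mem hJ, ?_⟩
  conv_lhs => rw [← h]
  exact Finset.card_insert_of_notMem (by simp)

theorem filter_lt_filter_lt (J : Finset (Fin n)) {t a : Fin n} (h : t ≤ a) :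
    (J.filter (· < a)).filter (· < t) = J.filter (· < t) := by
  rw [Finset.filter_filter]
  exact Finset.filter_congr fun i _ => ⟨fun h => h.2, fun h1 => ⟨h1.trans_le h, h1⟩⟩

/-- The number of heavy rows is controlled by the size of the residual. -/
theorem card_le_of_isHeavy {b : Fin n → Pt d} {μ L : ℝ} (hμ : 0 < μ) {J : Finset (Fin n)}
    (hheavy : ∀ t ∈ J, IsHeavy (1 / 4) μ b (J.filter (· < t)) t)
    (hres : ∀ t ∈ J, residual k b (J.filter (· < t)) < 3 * k * μ)
    (hL : ∑ i, ‖b i‖ ^ 2 ≤ L * μ) :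
    (J.card : ℝ) ≤ 1 + 5 * (k * Real.log (1 + L) + 3 * k) := by
  have hL0 : 0 ≤ L := nonneg_of_mul_nonneg_left
    ((Finset.sum_nonneg fun _ _ => sq_nonneg _).trans hL) hμ
  have hlog : 0 ≤ Real.log (1 + L) := Real.log_nonneg (by linarith)
  rcases J.eq_empty_or_nonempty with rfl | hne
  · simp only [Finset.card_empty, Nat.cast_zero]
    positivity
  -- The residual bound is known only just before each row. Dropping the last row `a` gives a set
  -- `I` to which it applies, and accounts for the summand 1.
  obtain ⟨a, haJ, hcard⟩ := exists_card_eq_card_filter_lt_add_one hne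
  set I := J.filter (· < a) with hI
  obtain ⟨W, hW, hWlt⟩ := exists_sqDist_lt (hres a haJ)
  have h1 := pow_card_le_det_ridgeMatrix (s := 1 / 4) (by norm_num) hμ I fun t ht => by
    have ht' := Finset.mem_filter.1 ht
    rw [hI, filter_lt_filter_lt J ht'.2.le]
    exact hheavy t ht'.1
  have hLI : ∑ i ∈ I, ‖b i‖ ^ 2 ≤ L * μ :=
    (Finset.sum_le_sum_of_subset_of_nonneg (Finset.subset_univ _) fun _ _ _ => sq_nonneg _).trans
      hL
  have h2 := h1.trans (det_ridgeMatrix_le hμ hLI hW)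
  rw [mul_comm (μ ^ d)] at h2
  have h3 := le_of_mul_le_mul_right h2 (by positivity)
  have h4 := Real.log_le_log (by positivity) h3
  rw [Real.log_pow, Real.log_mul (by positivity) (by positivity), Real.log_pow,
    Real.log_exp] at h4
  have h5 : sqDist b I W / μ ≤ 3 * k := by
    rw [div_le_iff₀ hμ]
    exact hWlt.le
  have h6 : (I.card : ℝ) * (1 / 5) ≤ I.card * Real.log (1 + 1 / 4) :=
    mul_le_mul_of_nonneg_left one_div_five_le_log (Nat.cast_nonneg _)
  rw [hcard]
  push_cast
  linarith

end Potential

end FlatFit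

namespace FlatFit

open Module Matrix

local notation "⟪" x ", " y "⟫" => inner ℝ x y

/-! ### Singular value bounds for the energy -/

section SingularValues

variable {n d k : ℕ}

theorem sigmaMin_mem {ι : Type} [Fintype ι] {M : Matrix ι (Fin d) ℝ} (hM : M ≠ 0) :
    sigmaMin M ∈ {s : ℝ | s ≠ 0 ∧ ∃ j : ℕ, s = (toEuclideanLin M).singularValues j} := by
  apply Set.Nonempty.csInf_mem
  · have h : (toEuclideanLin M).singularValues ≠ 0 := by
      rw [Ne, LinearMap.singularValues_eq_zero_iff]
      simpa using hM
    obtain ⟨j, hj⟩ := DFunLike.ne_iff.1 h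
    exact ⟨_, hj, j, rfl⟩
  · refine ((toEuclideanLin M).singularValues.support.finite_toSet.image
      (toEuclideanLin M).singularValues).subset ?_
    rintro _ ⟨h, j, rfl⟩
    exact ⟨j, Finsupp.mem_support_iff.2 h, rfl⟩

theorem sigmaMin_pos {ι : Type} [Fintype ι] {M : Matrix ι (Fin d) ℝ} (hM : M ≠ 0) :
    0 < sigmaMin M := by
  obtain ⟨h, j, hj⟩ := sigmaMin_mem hM
  exact lt_of_le_of_ne (hj ▸ LinearMap.singularValues_nonneg _ j) h.symm

theorem sigmaMin_nonneg {ι : Type} [Fintype ι] (M : Matrix ι (Fin d) ℝ) : 0 ≤ sigmaMin M :=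
  Real.sInf_nonneg (by rintro _ ⟨-, j, rfl⟩; exact LinearMap.singularValues_nonneg _ j)

theorem sigmaMin_le {ι : Type} [Fintype ι] {M : Matrix ι (Fin d) ℝ} {j : ℕ}
    (h : (toEuclideanLin M).singularValues j ≠ 0) :
    sigmaMin M ≤ (toEuclideanLin M).singularValues j :=
  csInf_le ⟨0, by rintro _ ⟨-, j, rfl⟩; exact LinearMap.singularValues_nonneg _ j⟩ ⟨h, j, rfl⟩

theorem sigmaMin_sq_mul_le {ι : Type} [Fintype ι] (M : Matrix ι (Fin d) ℝ) {x : Pt d}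
    (hx : x ∈ (LinearMap.ker (toEuclideanLin M))ᗮ) :
    sigmaMin M ^ 2 * ‖x‖ ^ 2 ≤ ‖toEuclideanLin M x‖ ^ 2 := by
  set T := toEuclideanLin M with hT
  have hs := T.isSymmetric_adjoint_comp_self
  have hd : finrank ℝ (Pt d) = d := finrank_euclideanSpace_fin
  set u := hs.eigenvectorBasis hd
  have happ : ∀ i, (LinearMap.adjoint T ∘ₗ T) (u i) = hs.eigenvalues hd i • u i :=
    fun i => hs.apply_eigenvectorBasis hd i
  have h1 : ‖T x‖ ^ 2 = ∑ i, hs.eigenvalues hd i * ⟪u i, x⟫ ^ 2 := by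
    rw [← real_inner_self_eq_norm_sq, ← LinearMap.adjoint_inner_right,
      ← u.sum_inner_mul_inner]
    refine Finset.sum_congr rfl fun i _ => ?_
    have h2 : ⟪u i, (LinearMap.adjoint T) (T x)⟫ = hs.eigenvalues hd i * ⟪u i, x⟫ := by
      have := hs (u i) x
      rw [happ, real_inner_smul_left] at this
      exact this.symm
    rw [h2, real_inner_comm]
    ring
  rw [h1, ← u.sum_sq_norm_inner_right, Finset.mul_sum]
  refine Finset.sum_le_sum fun i _ => ?_
  rw [Real.norm_eq_abs, sq_abs]
  have h3 := T.sq_singularValues_fin hd i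
  rw [← h3]
  -- A vanishing singular value has its eigenvector in the kernel, to which `x` is orthogonal; every
  -- other one is at least `sigmaMin M`.
  by_cases h0 : T.singularValues i = 0
  · have h4 : T (u i) = 0 := by
      have h5 : ⟪T (u i), T (u i)⟫ = 0 := by
        rw [← LinearMap.adjoint_inner_right]
        have := happ i
        rw [← h3, h0, LinearMap.comp_apply] at this
        rw [this]
        simp
      exact inner_self_eq_zero.1 h5
    rw [(Submodule.mem_orthogonal _ x).1 hx _ (LinearMap.mem_ker.2 h4)]
    simp
  · have := sigmaMin_le h0
    have := sigmaMin_nonneg M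
    gcongr

theorem norm_toEuclideanLin_rowsMatrix (b : Fin n → Pt d) (S : Finset (Fin n)) (x : Pt d) :
    ‖toEuclideanLin (rowsMatrix b S) x‖ ^ 2 = energy b S x := by
  rw [EuclideanSpace.real_norm_sq_eq, energy]
  simp only [inner_eq_dotProduct]
  exact Finset.sum_coe_sort S fun i => ((b i).ofLp ⬝ᵥ x.ofLp) ^ 2

theorem sigmaMin_rowsMatrix_sq_mul_le (b : Fin n → Pt d) (S : Finset (Fin n)) {x : Pt d}
    (hx : x ∈ rowSpace b S) : sigmaMin (rowsMatrix b S) ^ 2 * ‖x‖ ^ 2 ≤ energy b S x := by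
  rw [← norm_toEuclideanLin_rowsMatrix]
  refine sigmaMin_sq_mul_le _ ((Submodule.mem_orthogonal _ x).2 fun y hy => ?_)
  rw [real_inner_comm]
  refine inner_eq_zero_of_energy_eq_zero ?_ hx
  rw [← norm_toEuclideanLin_rowsMatrix, LinearMap.mem_ker.1 hy]
  simp

theorem specNorm_nonneg (b : Fin n → Pt d) (S : Finset (Fin n)) : 0 ≤ specNorm (rowsMatrix b S) :=
  norm_nonneg _

theorem energy_le_specNorm_sq_mul (b : Fin n → Pt d) (S : Finset (Fin n)) (x : Pt d) :
    energy b S x ≤ specNorm (rowsMatrix b S) ^ 2 * ‖x‖ ^ 2 := by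
  rw [← norm_toEuclideanLin_rowsMatrix, ← mul_pow]
  gcongr
  exact (toEuclideanLin (rowsMatrix b S)).toContinuousLinearMap.le_opNorm x

theorem norm_sq_le_specNorm_sq (b : Fin n → Pt d) {S : Finset (Fin n)} {i : Fin n} (hi : i ∈ S) :
    ‖b i‖ ^ 2 ≤ specNorm (rowsMatrix b S) ^ 2 := by
  have h1 := energy_le_specNorm_sq_mul b S (b i)
  have h2 : ⟪b i, b i⟫ ^ 2 ≤ energy b S (b i) :=
    Finset.single_le_sum (f := fun j => ⟪b j, b i⟫ ^ 2) (fun _ _ => sq_nonneg _) hi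
  rw [real_inner_self_eq_norm_sq] at h2
  rcases (sq_nonneg ‖b i‖).eq_or_lt with h0 | h0
  · rw [← h0]
    positivity
  · refine le_of_mul_le_mul_right ?_ h0
    rw [← sq]
    linarith

theorem rowsMatrix_ne_zero_iff (b : Fin n → Pt d) (S : Finset (Fin n)) :
    rowsMatrix b S ≠ 0 ↔ rowSpace b S ≠ ⊥ := by
  rw [not_iff_not]
  constructor
  · intro h
    rw [← Submodule.finrank_eq_zero, ← rank_rowsMatrix, h, rank_zero]
  · intro h
    ext i j
    have hi : b i = 0 := (Submodule.mem_bot ℝ).1 (h ▸ mem_rowSpace b i.2)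
    change b i j = 0
    rw [hi]
    rfl

theorem sigmaMin_le_specNorm {b : Fin n → Pt d} {S : Finset (Fin n)} (h : rowSpace b S ≠ ⊥) :
    sigmaMin (rowsMatrix b S) ≤ specNorm (rowsMatrix b Finset.univ) := by
  obtain ⟨x, hx, hx0⟩ := Submodule.exists_mem_ne_zero_of_ne_bot h
  have h1 := sigmaMin_rowsMatrix_sq_mul_le b S hx
  have h2 := (energy_mono b (Finset.subset_univ S) x).trans (energy_le_specNorm_sq_mul b _ x)
  exact le_of_sq_le_sq (le_of_mul_le_mul_right (h1.trans h2) (by positivity))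
    (specNorm_nonneg _ _)

end SingularValues

/-! ### Prefixes of the stream and the condition number -/

section Prefixes

variable {n d k : ℕ}

/-- The indices of the first `i` rows. -/
def firstRows (n i : ℕ) : Finset (Fin n) :=
  Finset.univ.filter fun j : Fin n => j.val < i

theorem mem_firstRows {i : ℕ} {j : Fin n} : j ∈ firstRows n i ↔ j.val < i := by
  simp [firstRows]

theorem firstRows_zero : firstRows n 0 = ∅ := by
  ext j; simp [mem_firstRows]

theorem firstRows_self : firstRows n n = Finset.univ := by
  ext j; simp [mem_firstRows]

theorem firstRows_succ (t : Fin n) : firstRows n (t + 1) = insert t (firstRows n t) := by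
  ext j; simp only [mem_firstRows, Finset.mem_insert, Fin.ext_iff]; omega

theorem notMem_firstRows (t : Fin n) : t ∉ firstRows n t := by simp [mem_firstRows]

theorem firstRows_mono {i j : ℕ} (h : i ≤ j) : firstRows n i ⊆ firstRows n j := fun _ ht =>
  mem_firstRows.2 ((mem_firstRows.1 ht).trans_le h)

/-- The denominator of the online condition number. -/
noncomputable def minSigma (k : ℕ) (b : Fin n → Pt d) : ℝ :=
  sInf {s : ℝ | ∃ i : ℕ, 1 ≤ i ∧ i ≤ n ∧ i ≤ iStar k b + 1 ∧
    prefixMatrix b i ≠ 0 ∧ s = sigmaMin (prefixMatrix b i)}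

theorem onlineCond_eq (k : ℕ) (b : Fin n → Pt d) :
    onlineCond k b = specNorm (rowsMatrix b Finset.univ) / minSigma k b := rfl

theorem finrank_rowSpace_insert_le (b : Fin n → Pt d) (S : Finset (Fin n)) (t : Fin n) :
    finrank ℝ (rowSpace b (insert t S)) ≤ finrank ℝ (rowSpace b S) + 1 := by
  rw [rowSpace_insert]
  by_cases h : b t ∈ rowSpace b S
  · rw [sup_eq_left.2 ((Submodule.span_singleton_le_iff_mem _ _).2 h)]
    omega
  · rw [Submodule.finrank_sup_span_singleton h]

theorem exists_finrank_firstRows_eq {b : Fin n → Pt d}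
    (h : k < finrank ℝ (rowSpace b Finset.univ)) :
    ∃ t : Fin n, finrank ℝ (rowSpace b (firstRows n t)) = k ∧
      k < finrank ℝ (rowSpace b (firstRows n (t + 1))) := by
  classical
  have hex : ∃ i, k < finrank ℝ (rowSpace b (firstRows n i)) := ⟨n, by rwa [firstRows_self]⟩
  have h1 := Nat.find_spec hex
  have h2 : Nat.find hex ≤ n := Nat.find_min' hex (by rwa [firstRows_self])
  have h3 : Nat.find hex ≠ 0 := by
    intro h0
    rw [h0, firstRows_zero] at h1
    rw [rowSpace, Finset.coe_empty, Set.image_empty, Submodule.span_empty, finrank_bot] at h1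
    omega
  obtain ⟨j, hj⟩ := Nat.exists_eq_succ_of_ne_zero h3
  have h4 : ¬ k < finrank ℝ (rowSpace b (firstRows n j)) := Nat.find_min hex (by omega)
  have h5 := finrank_rowSpace_insert_le b (firstRows n j) ⟨j, by omega⟩
  rw [hj] at h1
  have h6 := firstRows_succ (⟨j, by omega⟩ : Fin n)
  refine ⟨⟨j, by omega⟩, ?_, h1⟩
  simp only at h6
  rw [← h6] at h5
  simp only
  change k < finrank ℝ (rowSpace b (firstRows n (j + 1))) at h1
  omega

/-- The rank grows by at most one per row, so it equals `k` just before it first exceeds `k`; every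
prefix of rank at most `k` ends no later than that. -/
theorem le_iStar {b : Fin n → Pt d} (h : k < finrank ℝ (rowSpace b Finset.univ)) {i : ℕ}
    (hi : finrank ℝ (rowSpace b (firstRows n i)) ≤ k) : i ≤ iStar k b := by
  obtain ⟨t, ht, ht'⟩ := exists_finrank_firstRows_eq h
  have h1 : t.val ≤ iStar k b := Nat.le_findGreatest t.2.le ((rank_rowsMatrix _ _).trans ht)
  refine le_trans ?_ h1
  by_contra! hlt
  have := Submodule.finrank_mono (rowSpace_mono b (firstRows_mono (n := n) hlt))
  simp only [Nat.succ_eq_add_one] at this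
  omega

theorem minSigma_le {b : Fin n → Pt d} {i : ℕ} (h1 : 1 ≤ i) (h2 : i ≤ n)
    (h3 : i ≤ iStar k b + 1) (h4 : rowSpace b (firstRows n i) ≠ ⊥) :
    minSigma k b ≤ sigmaMin (rowsMatrix b (firstRows n i)) :=
  csInf_le ⟨0, by rintro _ ⟨i, -, -, -, -, rfl⟩; exact sigmaMin_nonneg _⟩
    ⟨i, h1, h2, h3, (rowsMatrix_ne_zero_iff _ _).2 h4, rfl⟩

theorem minSigma_nonneg (k : ℕ) (b : Fin n → Pt d) : 0 ≤ minSigma k b :=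
  Real.sInf_nonneg (by rintro _ ⟨i, -, -, -, -, rfl⟩; exact sigmaMin_nonneg _)

theorem minSigma_pos_and_le {b : Fin n → Pt d} (h : k < finrank ℝ (rowSpace b Finset.univ)) :
    0 < minSigma k b ∧ minSigma k b ≤ specNorm (rowsMatrix b Finset.univ) := by
  obtain ⟨t, ht, ht'⟩ := exists_finrank_firstRows_eq h
  have hne : rowSpace b (firstRows n (t + 1)) ≠ ⊥ := by
    intro h0
    rw [h0, finrank_bot] at ht'
    omega
  have h1 : t.val + 1 ≤ iStar k b + 1 := Nat.succ_le_succ (le_iStar h ht.le)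
  constructor
  · obtain ⟨i, -, -, -, h0, heq⟩ : minSigma k b ∈ {s : ℝ | ∃ i : ℕ, 1 ≤ i ∧ i ≤ n ∧
        i ≤ iStar k b + 1 ∧ prefixMatrix b i ≠ 0 ∧ s = sigmaMin (prefixMatrix b i)} := by
      apply Set.Nonempty.csInf_mem
      · exact ⟨_, t + 1, by omega, t.2, h1, (rowsMatrix_ne_zero_iff _ _).2 hne, rfl⟩
      · refine ((Set.finite_Iic n).image fun i => sigmaMin (prefixMatrix b i)).subset ?_
        rintro _ ⟨i, -, hi, -, -, rfl⟩
        exact ⟨i, hi, rfl⟩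
    rw [heq]
    exact sigmaMin_pos h0
  · exact (minSigma_le (by omega) t.2 h1 hne).trans (sigmaMin_le_specNorm hne)

/-- The rank hypothesis is on the prefix of length `t`, while the bound is for length `t + 1`: this
is why the minimum defining $\kappa'$ runs to $i^*+1$. It covers the row at which the rank passes
`k`. -/
theorem minSigma_sq_mul_le {b : Fin n → Pt d} (h : k < finrank ℝ (rowSpace b Finset.univ))
    {t : ℕ} (ht : t < n) (hrank : finrank ℝ (rowSpace b (firstRows n t)) ≤ k) {x : Pt d}
    (hx : x ∈ rowSpace b (firstRows n (t + 1))) :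
    minSigma k b ^ 2 * ‖x‖ ^ 2 ≤ energy b (firstRows n (t + 1)) x := by
  by_cases h0 : rowSpace b (firstRows n (t + 1)) = ⊥
  · rw [h0, Submodule.mem_bot] at hx
    rw [hx, norm_zero]
    have := energy_nonneg b (firstRows n (t + 1)) 0
    simpa using this
  · refine le_trans ?_ (sigmaMin_rowsMatrix_sq_mul_le b _ hx)
    have h1 := minSigma_le (k := k) (b := b) (by omega) ht
      (Nat.succ_le_succ (le_iStar h hrank)) h0
    have := minSigma_nonneg k b
    gcongr

theorem minSigma_sq_mul_le_of_mem {b : Fin n → Pt d} (h : k < finrank ℝ (rowSpace b Finset.univ))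
    {t : ℕ} (ht : t ≤ n) (hrank : finrank ℝ (rowSpace b (firstRows n t)) ≤ k) {x : Pt d}
    (hx : x ∈ rowSpace b (firstRows n t)) :
    minSigma k b ^ 2 * ‖x‖ ^ 2 ≤ energy b (firstRows n t) x := by
  cases t with
  | zero =>
    rw [firstRows_zero] at hx
    have hx0 : x = 0 := by simpa [rowSpace] using hx
    rw [hx0, norm_zero]
    have := energy_nonneg b (firstRows n 0) 0
    simpa using this
  | succ t =>
    refine minSigma_sq_mul_le h ht (le_trans ?_ hrank) hx
    exact Submodule.finrank_mono (rowSpace_mono b (firstRows_mono t.le_succ))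

end Prefixes

end FlatFit

namespace FlatFit

open Module

local notation "⟪" x ", " y "⟫" => inner ℝ x y

/-! ### Invariants of the streaming algorithm -/

section Streaming

variable {n d k : ℕ} {b : Fin n → Pt d}

theorem coresetAfter_succ_of_selects {t : ℕ} (ht : t < n)
    (h : Selects k b (coresetAfter k b t) ⟨t, ht⟩) :
    coresetAfter k b (t + 1) = insert ⟨t, ht⟩ (coresetAfter k b t) := by
  rw [coresetAfter, dif_pos ht, if_pos h]

theorem coresetAfter_succ_of_not_selects {t : ℕ} (ht : t < n)
    (h : ¬ Selects k b (coresetAfter k b t) ⟨t, ht⟩) :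
    coresetAfter k b (t + 1) = coresetAfter k b t := by
  rw [coresetAfter, dif_pos ht, if_neg h]

theorem coresetAfter_succ_of_le {t : ℕ} (h : n ≤ t) :
    coresetAfter k b (t + 1) = coresetAfter k b t := by
  rw [coresetAfter, dif_neg (by omega)]

theorem coresetAfter_mono : Monotone (coresetAfter k b) := by
  refine monotone_nat_of_le_succ fun t => ?_
  rcases Nat.lt_or_ge t n with h | h
  · by_cases hs : Selects k b (coresetAfter k b t) ⟨t, h⟩
    · rw [coresetAfter_succ_of_selects h hs]
      exact Finset.subset_insert _ _
    · rw [coresetAfter_succ_of_not_selects h hs]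
  · rw [coresetAfter_succ_of_le h]

theorem mem_coresetAfter_iff {i : ℕ} {t : Fin n} :
    t ∈ coresetAfter k b i ↔ t.val < i ∧ Selects k b (coresetAfter k b t) t := by
  constructor
  · induction i with
    | zero => simp [coresetAfter]
    | succ i ih =>
      intro h
      rcases Nat.lt_or_ge i n with hi | hi
      · by_cases hs : Selects k b (coresetAfter k b i) ⟨i, hi⟩
        · rw [coresetAfter_succ_of_selects hi hs, Finset.mem_insert] at h
          rcases h with rfl | h
          · exact ⟨Nat.lt_succ_self _, hs⟩
          · exact ⟨(ih h).1.trans (Nat.lt_succ_self _), (ih h).2⟩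
        · rw [coresetAfter_succ_of_not_selects hi hs] at h
          exact ⟨(ih h).1.trans (Nat.lt_succ_self _), (ih h).2⟩
      · rw [coresetAfter_succ_of_le hi] at h
        exact ⟨(ih h).1.trans (Nat.lt_succ_self _), (ih h).2⟩
  · rintro ⟨h1, h2⟩
    refine coresetAfter_mono (Nat.succ_le_of_lt h1) ?_
    rw [Nat.succ_eq_add_one, coresetAfter_succ_of_selects t.2 h2]
    exact Finset.mem_insert_self _ _

theorem mem_streamingCoreset_iff {t : Fin n} :
    t ∈ streamingCoreset k b ↔ Selects k b (coresetAfter k b t) t := by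
  rw [streamingCoreset, mem_coresetAfter_iff, and_iff_right t.2]

theorem filter_lt_subset_coresetAfter {J : Finset (Fin n)} (hJ : J ⊆ streamingCoreset k b)
    (t : Fin n) : J.filter (· < t) ⊆ coresetAfter k b t := fun i hi => by
  have h := Finset.mem_filter.1 hi
  exact mem_coresetAfter_iff.2 ⟨h.2, mem_streamingCoreset_iff.1 (hJ h.1)⟩

/-- The distortion of the streaming coreset is at most the square root of its size. -/
theorem isStrongCoreset_streamingCoreset (hk : 1 ≤ k) {β : ℝ} (hβ : 0 ≤ β)
    (h : ((streamingCoreset k b).card : ℝ) ≤ β ^ 2) :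
    IsStrongCoreset k b (streamingCoreset k b) β := by
  intro V hV
  set S := streamingCoreset k b with hS
  have hm := maxDist_nonneg b S V
  refine ⟨maxDist_mono b (Finset.subset_univ _) _, maxDist_le (by positivity) fun t _ => ?_⟩
  by_cases ht : t ∈ S
  · have h1 : 1 ≤ β := by
      have : (1 : ℝ) ≤ S.card := by exact_mod_cast Finset.card_pos.2 ⟨t, ht⟩
      exact (one_le_sq_iff₀ hβ).1 (this.trans h)
    exact (infDist_le_maxDist b V ht).trans (le_mul_of_one_le_left hm h1)
  · refine le_of_sq_le_sq ?_ (by positivity)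
    have hsub : coresetAfter k b t ⊆ S := coresetAfter_mono t.2.le
    rw [infDist_eq_norm_sub_starProjection]
    calc _ ≤ sqDist b (coresetAfter k b t) V :=
          norm_sub_starProjection_sq_le_of_not_selects hk
            (fun h => ht (mem_streamingCoreset_iff.2 h)) hV
      _ ≤ sqDist b S V := sqDist_mono b hsub V
      _ ≤ ∑ _i ∈ S, maxDist b S V ^ 2 := by
        refine Finset.sum_le_sum fun i hi => ?_
        rw [← infDist_eq_norm_sub_starProjection]
        exact pow_le_pow_left₀ Metric.infDist_nonneg (infDist_le_maxDist b V hi) 2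
      _ = S.card * maxDist b S V ^ 2 := by rw [Finset.sum_const, nsmul_eq_mul]
      _ ≤ β ^ 2 * maxDist b S V ^ 2 := by gcongr
      _ = _ := by ring

/-- Until the rank of the stream exceeds `k`, the selected rows span all rows and dominate them;
from then on the residual is bounded below. -/
theorem coresetAfter_invariant (h : k < finrank ℝ (rowSpace b Finset.univ)) {t : ℕ}
    (ht : t ≤ n) :
    (rowSpace b (coresetAfter k b t) = rowSpace b (firstRows n t) ∧
      finrank ℝ (rowSpace b (coresetAfter k b t)) ≤ k ∧
      ∀ x, energy b (firstRows n t) x ≤ t * energy b (coresetAfter k b t) x) ∨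
    minSigma k b ^ 2 / n ≤ residual k b (coresetAfter k b t) := by
  induction t with
  | zero =>
    left
    rw [firstRows_zero, coresetAfter]
    refine ⟨rfl, ?_, fun x => by simp [energy]⟩
    rw [rowSpace, Finset.coe_empty, Set.image_empty, Submodule.span_empty, finrank_bot]
    exact Nat.zero_le _
  | succ t ih =>
    rcases ih (by omega) with ⟨hspan, hrank, hen⟩ | hres
    swap
    · exact Or.inr (hres.trans (residual_mono b (coresetAfter_mono t.le_succ)))
    set i : Fin n := ⟨t, ht⟩
    have hfr : firstRows n (t + 1) = insert i (firstRows n t) := firstRows_succ i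
    have hfrn : i ∉ firstRows n t := notMem_firstRows i
    by_cases hs : Selects k b (coresetAfter k b t) i
    · have hc : coresetAfter k b (t + 1) = insert i (coresetAfter k b t) :=
        coresetAfter_succ_of_selects ht hs
      have hcn : i ∉ coresetAfter k b t := fun hi =>
        lt_irrefl _ (mem_coresetAfter_iff.1 hi).1
      have hspan' : rowSpace b (coresetAfter k b (t + 1)) = rowSpace b (firstRows n (t + 1)) := by
        rw [hc, hfr, rowSpace_insert, rowSpace_insert, hspan]
      have hen' : ∀ x, energy b (firstRows n (t + 1)) x ≤
          (t + 1 : ℕ) * energy b (coresetAfter k b (t + 1)) x := fun x => by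
        rw [hc, hfr, energy_insert b hfrn, energy_insert b hcn]
        have h1 := hen x
        have h2 := energy_nonneg b (coresetAfter k b t) x
        have h3 : 0 ≤ (t : ℝ) * ⟪b i, x⟫ ^ 2 := by positivity
        push_cast
        linarith
      by_cases hr : finrank ℝ (rowSpace b (coresetAfter k b (t + 1))) ≤ k
      · exact Or.inl ⟨hspan', hr, hen'⟩
      -- The rank has just exceeded `k`. On the whole row space the prefix energy is at least
      -- `minSigma k b ^ 2 * ‖x‖ ^ 2`, and domination loses at most a factor `n`, so Courant–Fischer
      -- bounds the residual below.
      · right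
        refine le_residual (not_le.1 hr) fun x hx => ?_
        rw [hspan'] at hx
        have h1 := (minSigma_sq_mul_le h ht (hspan ▸ hrank) hx).trans (hen' x)
        have hn : (0 : ℝ) < n := by exact_mod_cast (Nat.zero_lt_of_lt ht)
        rw [div_mul_eq_mul_div, div_le_iff₀ hn, mul_comm _ (n : ℝ)]
        refine h1.trans ?_
        have := energy_nonneg b (coresetAfter k b (t + 1)) x
        gcongr
    · have hc : coresetAfter k b (t + 1) = coresetAfter k b t :=
        coresetAfter_succ_of_not_selects ht hs
      -- Rank at most `k` makes the ridge parameter zero, so a rejected row lies in the current span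
      -- and its squared inner product with `x` is at most the selected energy.
      have hparam : ridgeParam k b (coresetAfter k b t) = 0 := by
        change residual k b _ / _ = 0
        rw [residual_eq_zero hrank, zero_div]
      left
      rw [hc]
      refine ⟨?_, hrank, fun x => ?_⟩
      · have hmem : b i ∈ rowSpace b (coresetAfter k b t) := by
          by_contra hmem
          exact hs (Or.inl ⟨hparam, hmem⟩)
        rw [hfr, rowSpace_insert, ← hspan, eq_comm, sup_eq_left,
          Submodule.span_singleton_le_iff_mem]
        exact hmem
      · have h1 := sq_inner_le_of_not_selects hs x
        have h2 := energy_nonneg b (coresetAfter k b t) x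
        have h3 := hen x
        rw [hparam, zero_mul, add_zero] at h1
        have h4 : 1 / (1 + 1 / (k : ℝ)) ≤ 1 :=
          div_le_one_of_le₀ (by have : (0 : ℝ) ≤ 1 / k := by positivity
                                linarith) (by positivity)
        have h5 := mul_le_mul_of_nonneg_right h4 h2
        rw [hfr, energy_insert b hfrn]
        push_cast
        linarith

theorem coresetAfter_dichotomy (h : k < finrank ℝ (rowSpace b Finset.univ)) (t : Fin n) :
    (finrank ℝ (rowSpace b (coresetAfter k b t)) ≤ k ∧
      ∀ x ∈ rowSpace b (coresetAfter k b t),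
        minSigma k b ^ 2 / n * ‖x‖ ^ 2 ≤ energy b (coresetAfter k b t) x) ∨
    minSigma k b ^ 2 / n ≤ residual k b (coresetAfter k b t) := by
  refine (coresetAfter_invariant h t.2.le).imp (fun ⟨h1, h2, h3⟩ => ⟨h2, fun x hx => ?_⟩) id
  have h4 := (minSigma_sq_mul_le_of_mem h t.2.le (h1 ▸ h2) (h1 ▸ hx)).trans (h3 x)
  have hn : (0 : ℝ) < n := by exact_mod_cast (Nat.zero_lt_of_lt t.2)
  rw [div_mul_eq_mul_div, div_le_iff₀ hn, mul_comm _ (n : ℝ)]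
  refine h4.trans ?_
  have := energy_nonneg b (coresetAfter k b t) x
  have := t.2.le
  gcongr

theorem half_le_threshold (hk : 1 ≤ k) : (1 : ℝ) / 2 ≤ 1 / (1 + 1 / (k : ℝ)) := by
  have : (1 : ℝ) ≤ k := by exact_mod_cast hk
  apply one_div_le_one_div_of_le (by positivity)
  have := div_le_one_of_le₀ this (by positivity)
  linarith

/-- A selected row in the span of the earlier ones is heavy for every small ridge parameter. -/
theorem isHeavy_of_mem_rowSpace (hk : 1 ≤ k) {S : Finset (Fin n)} {t : Fin n} {μ : ℝ}
    (hμ : ∀ x ∈ rowSpace b S, μ * ‖x‖ ^ 2 ≤ energy b S x) (hsel : Selects k b S t)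
    (hmem : b t ∈ rowSpace b S) : IsHeavy (1 / 4) μ b S t := by
  have hscore : 1 / (1 + 1 / (k : ℝ)) ≤ ridgeScore k b S t :=
    hsel.resolve_left fun h0 => h0.2 hmem
  obtain ⟨x, h1, h2⟩ := exists_of_le_ridgeScore one_half_pos ((half_le_threshold hk).trans hscore)
  -- Projecting the witness to the row space changes neither the energy nor the inner product with
  -- `b t`, and makes `hμ` applicable: the new ridge term is at most the energy. This halves the
  -- constant from 1/2 to 1/4.
  set y := (rowSpace b S).starProjection x with hy
  have hinner : ∀ v ∈ rowSpace b S, ⟪v, y⟫ = ⟪v, x⟫ := fun v hv => by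
    have := Submodule.starProjection_inner_eq_zero (K := rowSpace b S) x v hv
    rw [real_inner_comm, inner_sub_right, sub_eq_zero] at this
    exact this.symm
  have hen : energy b S y = energy b S x :=
    Finset.sum_congr rfl fun i hi => by rw [hinner _ (mem_rowSpace b hi)]
  refine ⟨y, ?_, by rwa [hinner _ hmem]⟩
  rw [hinner _ hmem]
  have h3 := hμ y (Submodule.starProjection_apply_mem _ _)
  have h4 : 0 ≤ ridgeParam k b S * ‖x‖ ^ 2 := mul_nonneg (ridgeParam_nonneg _ _ _) (sq_nonneg _)
  linarith

theorem isHeavy_of_residual_pos (hk : 1 ≤ k) {S : Finset (Fin n)} {t : Fin n} {μ : ℝ}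
    (hμ0 : 0 ≤ μ) (hμ : k * μ ≤ residual k b S) (hres : residual k b S ≠ 0)
    (hsel : Selects k b S t) : IsHeavy (1 / 4) μ b S t := by
  have hk0 : (0 : ℝ) < k := by exact_mod_cast hk
  have hscore : 1 / (1 + 1 / (k : ℝ)) ≤ ridgeScore k b S t :=
    hsel.resolve_left fun h0 => hres ((div_eq_zero_iff.1 h0.1).resolve_right hk0.ne')
  obtain ⟨x, h1, h2⟩ := exists_of_le_ridgeScore one_half_pos ((half_le_threshold hk).trans hscore)
  have h3 : IsHeavy (1 / 2) (ridgeParam k b S) b S t := ⟨x, h1, h2⟩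
  refine h3.mono (by norm_num) (by norm_num) hμ0 ?_ subset_rfl
  change μ ≤ residual k b S / k
  rwa [le_div_iff₀' hk0]

theorem card_le_finrank_rowSpace {J : Finset (Fin n)}
    (hJ : ∀ t ∈ J, b t ∉ rowSpace b (J.filter (· < t))) :
    J.card ≤ finrank ℝ (rowSpace b J) := by
  induction J using Finset.induction_on_max with
  | empty => simp
  | insert a J ha ih =>
    have haJ : a ∉ J := fun h => lt_irrefl _ (ha a h)
    have hf : ∀ t ∈ J, (insert a J).filter (· < t) = J.filter (· < t) := fun t ht => by
      rw [Finset.filter_insert, if_neg (not_lt.2 (ha t ht).le)]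
    have hfa : (insert a J).filter (· < a) = J := by
      rw [Finset.filter_insert, if_neg (lt_irrefl _), Finset.filter_true_of_mem ha]
    have h1 := ih fun t ht => hf t ht ▸ hJ t (Finset.mem_insert_of_mem ht)
    have h2 := hJ a (Finset.mem_insert_self _ _)
    rw [hfa] at h2
    rw [Finset.card_insert_of_notMem haJ, rowSpace_insert,
      Submodule.finrank_sup_span_singleton h2]
    omega

end Streaming

end FlatFit

namespace FlatFit

open Module

/-! ### Counting the selected rows -/

section Counting

variable {n d k : ℕ} {b : Fin n → Pt d}

theorem natCast_lt_of_lt_finrank (h : k < finrank ℝ (rowSpace b Finset.univ)) : k < n := by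
  refine h.trans_le ?_
  have h1 := finrank_range_le_card (R := ℝ) b
  rw [Fintype.card_fin] at h1
  rwa [rowSpace, Finset.coe_univ, Set.image_univ]

theorem two_le_mul_onlineCond (hk : 1 ≤ k) (h : k < finrank ℝ (rowSpace b Finset.univ)) :
    (n : ℝ) ≤ n * onlineCond k b ∧ 2 ≤ n * onlineCond k b := by
  obtain ⟨h1, h2⟩ := minSigma_pos_and_le h
  have h3 : 1 ≤ onlineCond k b := by
    rw [onlineCond_eq]
    exact (one_le_div h1).2 h2
  have h4 : (2 : ℝ) ≤ n := by
    have := natCast_lt_of_lt_finrank h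
    exact_mod_cast (by omega : 2 ≤ n)
  have h5 : (n : ℝ) ≤ n * onlineCond k b := le_mul_of_one_le_right (by positivity) h3
  exact ⟨h5, h4.trans h5⟩

theorem half_le_log (hk : 1 ≤ k) (h : k < finrank ℝ (rowSpace b Finset.univ)) :
    1 / 2 ≤ Real.log (n * onlineCond k b) := by
  have h1 := Real.log_le_log two_pos (two_le_mul_onlineCond hk h).2
  have h2 := Real.log_two_gt_d9
  linarith

theorem sum_norm_sq_le (h : k < finrank ℝ (rowSpace b Finset.univ)) :
    ∑ i, ‖b i‖ ^ 2 ≤ (n * onlineCond k b) ^ 2 * (minSigma k b ^ 2 / n) := by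
  have h1 : ∑ i, ‖b i‖ ^ 2 ≤ n * specNorm (rowsMatrix b Finset.univ) ^ 2 := by
    have := Finset.sum_le_card_nsmul Finset.univ (fun i => ‖b i‖ ^ 2) _
      fun i hi => norm_sq_le_specNorm_sq b hi
    simpa using this
  have h2 := (minSigma_pos_and_le h).1
  have hn : (0 : ℝ) < n := by exact_mod_cast Nat.zero_lt_of_lt (natCast_lt_of_lt_finrank h)
  refine h1.trans (le_of_eq ?_)
  rw [onlineCond_eq]
  field_simp

/-- A class of selected rows which are heavy for the same ridge parameter is small. -/
theorem card_class_le (hk : 1 ≤ k) (h : k < finrank ℝ (rowSpace b Finset.univ)) {μ : ℝ}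
    (hμ : minSigma k b ^ 2 / n ≤ k * μ) {J : Finset (Fin n)} (hJ : J ⊆ streamingCoreset k b)
    (hheavy : ∀ t ∈ J, IsHeavy (1 / 4) μ b (coresetAfter k b t) t)
    (hres : ∀ t ∈ J, residual k b (coresetAfter k b t) < 3 * k * μ) :
    (J.card : ℝ) ≤ 52 * (k * Real.log (n * onlineCond k b)) := by
  have hk1 : (1 : ℝ) ≤ k := by exact_mod_cast hk
  have hn : (k : ℝ) ≤ n := by exact_mod_cast (natCast_lt_of_lt_finrank h).le
  have hσ := (minSigma_pos_and_le h).1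
  have hn0 : (0 : ℝ) < n := by linarith
  have hμ0 : 0 < μ := by
    have : 0 < minSigma k b ^ 2 / n := by positivity
    exact pos_of_mul_pos_right (this.trans_le hμ) (by positivity)
  obtain ⟨hnK, hK⟩ := two_le_mul_onlineCond hk h
  have hℓ := half_le_log hk h
  set K := (n : ℝ) * onlineCond k b with hKdef
  -- The third power of `K` absorbs the factor `k` in `hμ`, since $k\le n\le K$.
  have hL : ∑ i, ‖b i‖ ^ 2 ≤ K ^ 3 * μ := by
    refine (sum_norm_sq_le h).trans ?_
    rw [← hKdef]
    calc K ^ 2 * (minSigma k b ^ 2 / n) ≤ K ^ 2 * (K * μ) := by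
          gcongr
          exact hμ.trans (by gcongr; linarith)
      _ = _ := by ring
  have h1 := card_le_of_isHeavy (k := k) hμ0 (J := J)
    (fun t ht => (hheavy t ht).mono (by norm_num) le_rfl hμ0.le le_rfl
      (filter_lt_subset_coresetAfter hJ t))
    (fun t ht => (residual_mono b (filter_lt_subset_coresetAfter hJ t)).trans_lt (hres t ht)) hL
  have h2 : Real.log (1 + K ^ 3) ≤ 4 * Real.log K := by
    have h3 : 1 + K ^ 3 ≤ K ^ 4 := by
      have : 1 ≤ K ^ 3 := one_le_pow₀ (by linarith)
      nlinarith
    have h4 := Real.log_le_log (by positivity) h3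
    rw [Real.log_pow] at h4
    exact_mod_cast h4
  have h3 : (k : ℝ) * Real.log (1 + K ^ 3) ≤ k * (4 * Real.log K) := by gcongr
  have h4 : (k : ℝ) * (1 / 2) ≤ k * Real.log K := by gcongr
  -- $1+5(4k\log K+3k)\le 20k\log K+16k$, and $k\le 2k\log K$; hence 52.
  linarith

/-- The rows selected because they leave the row space number at most `k + 1`. -/
theorem card_rank_increase_le (h : k < finrank ℝ (rowSpace b Finset.univ)) {J : Finset (Fin n)}
    (hJ : J ⊆ streamingCoreset k b) (hnot : ∀ t ∈ J, b t ∉ rowSpace b (coresetAfter k b t))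
    (hres : ∀ t ∈ J, residual k b (coresetAfter k b t) = 0) : J.card ≤ k + 1 := by
  rcases J.eq_empty_or_nonempty with rfl | hne
  · simp
  obtain ⟨a, haJ, hcard⟩ := exists_card_eq_card_filter_lt_add_one hne
  have hσ := (minSigma_pos_and_le h).1
  have hn : (0 : ℝ) < n := by exact_mod_cast Nat.zero_lt_of_lt (natCast_lt_of_lt_finrank h)
  have h1 : finrank ℝ (rowSpace b (coresetAfter k b a)) ≤ k := by
    refine (coresetAfter_dichotomy h a).elim (fun h => h.1) fun h2 => ?_
    have : 0 < minSigma k b ^ 2 / n := by positivity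
    rw [hres a haJ] at h2
    linarith
  have h2 : (J.filter (· < a)).card ≤ finrank ℝ (rowSpace b (J.filter (· < a))) := by
    refine card_le_finrank_rowSpace fun t ht => ?_
    have ht' := Finset.mem_filter.1 ht
    rw [filter_lt_filter_lt J ht'.2.le]
    exact fun hmem => hnot t ht'.1 (rowSpace_mono b (filter_lt_subset_coresetAfter hJ t) hmem)
  have h3 := Submodule.finrank_mono (rowSpace_mono b (filter_lt_subset_coresetAfter hJ a))
  omega

/-- The rows selected while the residual is positive, by dyadic scales of the residual. -/
theorem card_residual_pos_le (hk : 1 ≤ k) (h : k < finrank ℝ (rowSpace b Finset.univ))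
    {J : Finset (Fin n)} (hJ : J ⊆ streamingCoreset k b)
    (hres : ∀ t ∈ J, residual k b (coresetAfter k b t) ≠ 0) :
    (J.card : ℝ) ≤ 52 * (k * Real.log (n * onlineCond k b)) *
      (4 * Real.log (n * onlineCond k b) + 1) := by
  have hk1 : (1 : ℝ) ≤ k := by exact_mod_cast hk
  have hσ := (minSigma_pos_and_le h).1
  have hn0 : (0 : ℝ) < n := by exact_mod_cast Nat.zero_lt_of_lt (natCast_lt_of_lt_finrank h)
  obtain ⟨-, hK⟩ := two_le_mul_onlineCond hk h
  have hℓ := half_le_log hk h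
  have hF := sum_norm_sq_le h
  set K := (n : ℝ) * onlineCond k b with hKdef
  set ρ₀ := minSigma k b ^ 2 / n with hρ₀
  have hρ₀pos : 0 < ρ₀ := by positivity
  let ρ : Fin n → ℝ := fun t => residual k b (coresetAfter k b t)
  -- A nonzero residual rules out rank at most `k`, so the dichotomy leaves only the lower bound.
  have hρ : ∀ t ∈ J, ρ₀ ≤ ρ t := fun t ht =>
    (coresetAfter_dichotomy h t).resolve_left fun h1 => hres t ht (residual_eq_zero h1.1)
  have hρK : ∀ t, ρ t ≤ K ^ 2 * ρ₀ := fun t => by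
    refine le_trans ?_ hF
    refine (residual_le_sqDist b _ (V := ⊥) (by simp)).trans ?_
    refine (sqDist_mono b (Finset.subset_univ _) ⊥).trans (le_of_eq ?_)
    simp [sqDist]
  let scale : Fin n → ℕ := fun t => Nat.log 2 ⌊ρ t / ρ₀⌋₊
  have hfloor : ∀ t ∈ J, ⌊ρ t / ρ₀⌋₊ ≠ 0 := fun t ht => by
    have := (one_le_div hρ₀pos).2 (hρ t ht)
    exact (Nat.floor_pos.2 this).ne'
  have hlow : ∀ t ∈ J, (2 : ℝ) ^ scale t * ρ₀ ≤ ρ t := fun t ht => by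
    rw [← le_div_iff₀ hρ₀pos]
    have h1 : ((2 ^ scale t : ℕ) : ℝ) ≤ (⌊ρ t / ρ₀⌋₊ : ℝ) := by
      exact_mod_cast Nat.pow_log_le_self 2 (hfloor t ht)
    push_cast at h1
    exact h1.trans (Nat.floor_le (div_nonneg (residual_nonneg _ _ _) hρ₀pos.le))
  have hhigh : ∀ t ∈ J, ρ t < 2 ^ (scale t + 1) * ρ₀ := fun t _ => by
    rw [← div_lt_iff₀ hρ₀pos]
    have h1 : ⌊ρ t / ρ₀⌋₊ < 2 ^ (scale t + 1) := Nat.lt_pow_succ_log_self one_lt_two _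
    exact_mod_cast (Nat.floor_lt' (by positivity)).1 h1
  -- From $2^s\le K^2$ and $\log 2\ge 1/2$ one gets $s\le 4\log K$.
  set R := ⌊4 * Real.log K⌋₊ + 1 with hR
  have hmaps : ∀ t ∈ J, scale t ∈ Finset.range R := fun t ht => by
    rw [Finset.mem_range, hR, Nat.lt_succ_iff]
    refine Nat.le_floor ?_
    have h1 : (2 : ℝ) ^ scale t ≤ K ^ 2 :=
      le_of_mul_le_mul_right ((hlow t ht).trans (hρK t)) hρ₀pos
    have h2 := Real.log_le_log (by positivity) h1
    rw [Real.log_pow, Real.log_pow] at h2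
    have h3 := Real.log_two_gt_d9
    have h4 : (scale t : ℝ) * (1 / 2) ≤ scale t * Real.log 2 := by gcongr; linarith
    push_cast at h2
    linarith
  have hfiber : ∀ s ∈ Finset.range R,
      ((J.filter fun t => scale t = s).card : ℝ) ≤ 52 * (k * Real.log K) := fun s _ => by
    have hk0 : (0 : ℝ) < k := by linarith
    have hμ : (k : ℝ) * (2 ^ s * ρ₀ / k) = 2 ^ s * ρ₀ := by field_simp
    -- On scale `s` the parameter is chosen with $k\mu=2^s\rho_0$, so the residual lies in
    -- $[k\mu,2k\mu)$, within the allowed $3k\mu$.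
    refine card_class_le hk h (μ := 2 ^ s * ρ₀ / k) ?_ ((Finset.filter_subset _ _).trans hJ) ?_ ?_
    · rw [hμ]
      exact le_mul_of_one_le_left hρ₀pos.le (one_le_pow₀ one_le_two)
    · intro t ht
      obtain ⟨htJ, hts⟩ := Finset.mem_filter.1 ht
      refine isHeavy_of_residual_pos hk (by positivity) ?_ (hres t htJ)
        (mem_streamingCoreset_iff.1 (hJ htJ))
      rw [hμ, ← hts]
      exact hlow t htJ
    · intro t ht
      obtain ⟨htJ, hts⟩ := Finset.mem_filter.1 ht
      have h1 := hhigh t htJ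
      rw [hts, pow_succ] at h1
      have h2 : 0 < 2 ^ s * ρ₀ := by positivity
      rw [mul_assoc, hμ]
      linarith
  calc (J.card : ℝ) = ∑ s ∈ Finset.range R, ((J.filter fun t => scale t = s).card : ℝ) := by
        rw [Finset.card_eq_sum_card_fiberwise hmaps]
        push_cast
        rfl
    _ ≤ R • (52 * (k * Real.log K)) := by
        simpa using Finset.sum_le_card_nsmul _ _ _ hfiber
    _ = 52 * (k * Real.log K) * R := by rw [nsmul_eq_mul, mul_comm]
    _ ≤ _ := by
        gcongr
        rw [hR]
        push_cast
        have := Nat.floor_le (a := 4 * Real.log K) (by linarith)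
        linarith

theorem card_streamingCoreset_le (hk : 1 ≤ k) (h : k < finrank ℝ (rowSpace b Finset.univ)) :
    ((streamingCoreset k b).card : ℝ) ≤ (21 * (√(k : ℝ) * Real.log (n * onlineCond k b))) ^ 2 := by
  classical
  have hk1 : (1 : ℝ) ≤ k := by exact_mod_cast hk
  have hσ := (minSigma_pos_and_le h).1
  have hn0 : (0 : ℝ) < n := by exact_mod_cast Nat.zero_lt_of_lt (natCast_lt_of_lt_finrank h)
  have hρ₀pos : 0 < minSigma k b ^ 2 / n := by positivity
  have hℓ := half_le_log hk h
  set ℓ := Real.log (n * onlineCond k b)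
  set S := streamingCoreset k b
  set Z := S.filter fun t : Fin n => residual k b (coresetAfter k b t) = 0
  have hZ : ∀ t ∈ Z, t ∈ S ∧ residual k b (coresetAfter k b t) = 0 := fun t ht =>
    Finset.mem_filter.1 ht
  have h1 : ((S.filter fun t : Fin n => residual k b (coresetAfter k b t) ≠ 0).card : ℝ) ≤
      52 * (k * ℓ) * (4 * ℓ + 1) :=
    card_residual_pos_le hk h (Finset.filter_subset _ _) fun t ht => (Finset.mem_filter.1 ht).2
  have h2 : ((Z.filter fun t : Fin n => b t ∈ rowSpace b (coresetAfter k b t)).card : ℝ) ≤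
      52 * (k * ℓ) := by
    -- Here `μ` is `minSigma k b ^ 2 / n` itself. Residual zero excludes the second branch of the
    -- dichotomy, so the energy on the row space is at least $\mu\|x\|^2$.
    refine card_class_le hk h (le_mul_of_one_le_left hρ₀pos.le hk1)
      ((Finset.filter_subset _ _).trans (Finset.filter_subset _ _)) ?_ ?_
    · intro t ht
      obtain ⟨htZ, htm⟩ := Finset.mem_filter.1 ht
      refine isHeavy_of_mem_rowSpace hk ?_ (mem_streamingCoreset_iff.1 (hZ t htZ).1) htm
      refine (coresetAfter_dichotomy h t).elim (fun h => h.2) fun h2 => ?_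
      rw [(hZ t htZ).2] at h2
      linarith
    · intro t ht
      rw [(hZ t (Finset.mem_filter.1 ht).1).2]
      positivity
  have h3 : ((Z.filter fun t : Fin n => b t ∉ rowSpace b (coresetAfter k b t)).card : ℝ) ≤
      k + 1 := by
    exact_mod_cast card_rank_increase_le h
      ((Finset.filter_subset _ _).trans (Finset.filter_subset _ _))
      (fun t ht => (Finset.mem_filter.1 ht).2)
      (fun t ht => (hZ t (Finset.mem_filter.1 ht).1).2)
  have h4 : S.card = (Z.filter fun t : Fin n => b t ∈ rowSpace b (coresetAfter k b t)).card +
      (Z.filter fun t : Fin n => b t ∉ rowSpace b (coresetAfter k b t)).card +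
      (S.filter fun t : Fin n => residual k b (coresetAfter k b t) ≠ 0).card := by
    rw [Finset.card_filter_add_card_filter_not, Finset.card_filter_add_card_filter_not]
  rw [h4, mul_pow, mul_pow, Real.sq_sqrt (by positivity)]
  push_cast
  -- With $\ell\ge 1/2$ the three classes total at most $(208+208+8)k\ell^2$, below $21^2k\ell^2$.
  have h5 : (k : ℝ) * ℓ ≤ 2 * (k * ℓ ^ 2) := by
    nlinarith [mul_nonneg (by linarith : (0 : ℝ) ≤ k) (by linarith : 0 ≤ ℓ)]
  have h6 : (k : ℝ) ≤ 2 * (k * ℓ) := by nlinarith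
  nlinarith

theorem isStrongCoreset_streamingCoreset_log (hk : 1 ≤ k)
    (h : k < finrank ℝ (rowSpace b Finset.univ)) :
    IsStrongCoreset k b (streamingCoreset k b)
      (21 * (√(k : ℝ) * Real.log (n * onlineCond k b))) := by
  have hℓ := half_le_log hk h
  exact isStrongCoreset_streamingCoreset hk
    (mul_nonneg (by norm_num) (mul_nonneg (Real.sqrt_nonneg _) (by linarith)))
    (card_streamingCoreset_le hk h)

end Counting

end FlatFit

/-! ### Assembly of the two halves -/

theorem mainTheorem5 :
    ∃ C : ℝ, 0 < C ∧
      ∀ (n d k : ℕ) [NeZero n] (a : Fin n → FlatFit.Pt d), k ≤ d →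
        -- any strong coreset `S` of distortion `β` for the translated points `a_i - a_1`
        (∀ (S : Finset (Fin n)) (β : ℝ),
          FlatFit.IsStrongCoreset k (fun i => a i - a 0) S β →
            (FlatFit.outerRadius k a (insert 0 S) ≤ FlatFit.outerRadius k a Finset.univ ∧
              FlatFit.outerRadius k a Finset.univ
                ≤ C * β * FlatFit.outerRadius k a (insert 0 S)) ∧
            (FlatFit.subspaceRadius k (fun i => a i - a 0) S
                ≤ C * FlatFit.outerRadius k a Finset.univ ∧
              FlatFit.outerRadius k a Finset.univ
                ≤ C * β * FlatFit.subspaceRadius k (fun i => a i - a 0) S)) ∧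
        -- the coreset selected by the streaming algorithm on the rows `a_i - a_1`
        (1 ≤ k →
          ∀ S : Finset (Fin n), S = FlatFit.streamingCoreset k (fun i => a i - a 0) →
          ∀ κ' : ℝ, κ' = FlatFit.onlineCond k (fun i => a i - a 0) →
            (FlatFit.outerRadius k a (insert 0 S) ≤ FlatFit.outerRadius k a Finset.univ ∧
              FlatFit.outerRadius k a Finset.univ
                ≤ C * (√(k : ℝ) * Real.log (n * κ')) * FlatFit.outerRadius k a (insert 0 S)) ∧
            (FlatFit.subspaceRadius k (fun i => a i - a 0) S
                ≤ C * FlatFit.outerRadius k a Finset.univ ∧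
              FlatFit.outerRadius k a Finset.univ
                ≤ C * (√(k : ℝ) * Real.log (n * κ')) *
                  FlatFit.subspaceRadius k (fun i => a i - a 0) S)) := by
  -- 42 is the coreset constant 21 times the factor 2 for moving flats to the base point.
  refine ⟨42, by norm_num, fun n d k _ a hk => ⟨fun S β h => ?_, ?_⟩⟩
  · have hR := FlatFit.outerRadius_nonneg (k := k) a Finset.univ
    obtain ⟨h1, h2⟩ := FlatFit.outerRadius_le_of_isStrongCoreset hk a h
    refine ⟨⟨FlatFit.outerRadius_mono hk a (Finset.subset_univ _), by linarith⟩, ?_, by linarith⟩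
    linarith [FlatFit.subspaceRadius_le_two_mul_outerRadius hk a S]
  · rintro hk1 S rfl κ' rfl
    set S := FlatFit.streamingCoreset k fun i => a i - a 0 with hS
    have hR := FlatFit.outerRadius_nonneg (k := k) a Finset.univ
    have h3 := FlatFit.subspaceRadius_le_two_mul_outerRadius hk a S
    have h4 := FlatFit.outerRadius_mono hk a (Finset.subset_univ (insert 0 S))
    refine ⟨⟨h4, ?_⟩, by linarith, ?_⟩ <;>
      rcases Nat.lt_or_ge k (Module.finrank ℝ
        (FlatFit.rowSpace (fun i => a i - a 0) Finset.univ)) with h | h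
    · have := (FlatFit.outerRadius_le_of_isStrongCoreset hk a
        (FlatFit.isStrongCoreset_streamingCoreset_log hk1 h)).1
      linarith
    -- At rank at most `k` both sides are zero, whatever value the logarithm takes.
    · rw [FlatFit.rowSpace, Finset.coe_univ, Set.image_univ] at h
      have h0 := FlatFit.outerRadius_univ_eq_zero hk a h
      have h5 : FlatFit.outerRadius k a (insert 0 S) = 0 :=
        le_antisymm (h0 ▸ h4) (FlatFit.outerRadius_nonneg _ _)
      rw [h0, h5, mul_zero]
    · have := (FlatFit.outerRadius_le_of_isStrongCoreset hk a
        (FlatFit.isStrongCoreset_streamingCoreset_log hk1 h)).2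
      linarith
    · rw [FlatFit.rowSpace, Finset.coe_univ, Set.image_univ] at h
      have h0 := FlatFit.outerRadius_univ_eq_zero hk a h
      have h5 : FlatFit.subspaceRadius k (fun i => a i - a 0) S = 0 :=
        le_antisymm (by linarith) (FlatFit.subspaceRadius_nonneg _ _)
      rw [h0, h5, mul_zero]
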